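/- **Setting.** Let $x_{k+1}=Ax_k+\omega_k$, $y_k=Cx_k+\nu_k$, $k=0,1,2,\dots$, with $A\in\mathbb R^{n\times n}$, $C\in\mathbb R^{m\times n}$, $q=\operatorname{rank} C$, $x_0\sim\mathcal N(\bar x_0,P_0^{\mathrm{init}})$, and $\omega$, $\nu$ zero-mean Gaussian white noises with covariances $Q$, $R$. The initial state, the process noise sequence and the measurement noise sequence are independent. Here $P_0^{\mathrm{init}}\succ0$, $R\succ0$, $Q\succeq0$ and $AA'+Q\succ0$ (the last two hold in particular if $Q\succ0$). The sensor runs the Kalman filter started from $\hat x^L_{0|-1}=\bar x_0$, $P^L_{0|-1}=P_0^{\mathrm{init}}$: $$K^L_k=P^L_{k|k-1}C'(CP^L_{k|k-1}C'+R)^{-1},\quad z_k=K^L_k(y_k-C\hat x^L_{k|k-1}),\quad \hat x^L_k=\hat x^L_{k|k-1}+z_k,$$ $$P^L_k=P^L_{k|k-1}-K^L_kCP^L_{k|k-1},\quad \hat x^L_{k+1|k}=A\hat x^L_k,\quad P^L_{k+1|k}=AP^L_kA'+Q .$$ For each $k$ let $U_k$ be any orthogonal matrix with $U_k'(P^L_{k|k-1}-P^L_k)U_k=\operatorname{diag}(\Lambda_k,0)$,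 where $\Lambda_k$ is the diagonal matrix of the $q$ positive eigenvalues, and put $\epsilon_k=F_kz_k\in\mathbb R^q$ with $F_k=[\Lambda_k^{-1/2},0]U_k'$. **Trigger.** Let $\delta_1,\delta_2,\dots$ be real thresholds. Set $\gamma_0=1$ and, for $k\ge1$, $t_k=\max\{t<k:\gamma_t=1\}$, $\tau=\tau_k=k-t_k$, and $\gamma_k=1$ if $\sum_{i=t_k+1}^k\|\epsilon_i\|^2>\delta_k$, $\gamma_k=0$ otherwise. The remote center receives $\mathcal I_k=\{\gamma_k\hat x^L_k,\gamma_k\}$. Define $\hat x_k=\mathbb E[x_k\mid\mathcal I_0,\dots,\mathcal I_k]$ and $P_k=\mathbb E[(x_k-\hat x_k)(x_k-\hat x_k)'\mid\mathcal I_0,\dots,\mathcal I_k]$. **Weights.** Let $f(\cdot;q)$ be the density of the chi-square distribution with $q$ degrees of freedom. For $t<i\le k$ let $$\eta_i(\delta_{t+1}^k)=\frac1q\cdot\frac{\int_{D_{t+1}}f(u_{t+1};q)\cdots\int_{D_i}u_if(u_i;q)\cdots\int_{D_k}f(u_k;q)\,du_k\cdots du_{t+1}}{\int_{D_{t+1}}f(u_{t+1};q)\cdots\int_{D_k}f(u_k;q)\,du_k\cdots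 du_{t+1}},\qquad D_l=\Big[0,\ \delta_l-\sum_{h=t+1}^{l-1}u_h\Big],$$ where $D_l=\emptyset$ if its right end is negative. **Theorem.** Each $x_k$ is square integrable; almost surely $\hat x_0=\hat x^L_0$ and $P_0=P^L_0$; and for every $k\ge1$, almost surely, with $t=t_k$, $$\hat x_k=(1-\gamma_k)A\hat x_{k-1}+\gamma_k\hat x^L_k,$$ $$P_k=P^L_k+(1-\gamma_k)\sum_{i=0}^{\tau-1}\eta_{k-i}(\delta_{t+1}^k)\,A^i\big(P^L_{k-i|k-i-1}-P^L_{k-i}\big)(A^i)'.$$ -/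

import Mathlib

open MeasureTheory ProbabilityTheory
open scoped Matrix

noncomputable section

namespace RemoteEstimation

/-- Data of the linear time-invariant system `x (k+1) = A x k + w k`, `y k = C x k + v k`, with
process noise covariance `Q`, measurement noise covariance `R`, and initial mean and covariance. -/
structure LinearSystem (n m : ℕ) where
  A : Matrix (Fin n) (Fin n) ℝ
  C : Matrix (Fin m) (Fin n) ℝ
  Q : Matrix (Fin n) (Fin n) ℝ
  R : Matrix (Fin m) (Fin m) ℝ
  initMean : EuclideanSpace ℝ (Fin n)
  initCov : Matrix (Fin n) (Fin n) ℝ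

/-- The random inputs of the system: initial state, process noise, measurement noise. -/
structure Inputs (Ω : Type*) (n m : ℕ) where
  x0 : Ω → EuclideanSpace ℝ (Fin n)
  w : ℕ → Ω → EuclideanSpace ℝ (Fin n)
  v : ℕ → Ω → EuclideanSpace ℝ (Fin m)

variable {Ω : Type*} {n m q : ℕ}

/-- Standing assumptions on the random inputs: `x0 ∼ N(initMean, initCov)`; `w` and `v` are
zero-mean Gaussian white noises with covariances `Q` and `R`; and the initial state, the whole
process noise sequence and the whole measurement noise sequence are mutually independent. -/
structure Inputs.IsGaussianWhite [MeasurableSpace Ω] (μ : Measure Ω)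
    (S : LinearSystem n m) (N : Inputs Ω n m) : Prop where
  measurable_x0 : Measurable N.x0
  measurable_w : ∀ k, Measurable (N.w k)
  measurable_v : ∀ k, Measurable (N.v k)
  law_x0 : HasLaw N.x0 (multivariateGaussian S.initMean S.initCov) μ
  law_w : ∀ k, HasLaw (N.w k) (multivariateGaussian 0 S.Q) μ
  law_v : ∀ k, HasLaw (N.v k) (multivariateGaussian 0 S.R) μ
  white_w : iIndepFun N.w μ
  white_v : iIndepFun N.v μ
  indep_x0 : IndepFun N.x0 (fun ω => ((fun k => N.w k ω), (fun k => N.v k ω))) μ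
  indep_noise : IndepFun (fun ω k => N.w k ω) (fun ω k => N.v k ω) μ

namespace LinearSystem

/-- The state process `x`. -/
def state (S : LinearSystem n m) (N : Inputs Ω n m) : ℕ → Ω → EuclideanSpace ℝ (Fin n)
  | 0, ω => N.x0 ω
  | k + 1, ω => S.A.toEuclideanLin (S.state N k ω) + N.w k ω

/-- The measurement process `y`. -/
def output (S : LinearSystem n m) (N : Inputs Ω n m) (k : ℕ) (ω : Ω) : EuclideanSpace ℝ (Fin m) :=
  S.C.toEuclideanLin (S.state N k ω) + N.v k ω

/-- The Kalman gain belonging to a prior covariance `P`. -/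
def gainOf (S : LinearSystem n m) (P : Matrix (Fin n) (Fin n) ℝ) : Matrix (Fin n) (Fin m) ℝ :=
  P * S.Cᵀ * (S.C * P * S.Cᵀ + S.R)⁻¹

/-- The local prior covariance `P^L_{k|k-1}` (at time `0` it is the covariance of `x 0`). -/
def priorCov (S : LinearSystem n m) : ℕ → Matrix (Fin n) (Fin n) ℝ
  | 0 => S.initCov
  | k + 1 =>
      S.A * (S.priorCov k - S.gainOf (S.priorCov k) * S.C * S.priorCov k) * S.Aᵀ + S.Q

/-- The Kalman gain `K^L_k`. -/
def gain (S : LinearSystem n m) (k : ℕ) : Matrix (Fin n) (Fin m) ℝ := S.gainOf (S.priorCov k)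

/-- The local posterior covariance `P^L_k`. -/
def postCov (S : LinearSystem n m) (k : ℕ) : Matrix (Fin n) (Fin n) ℝ :=
  S.priorCov k - S.gain k * S.C * S.priorCov k

/-- The covariance `P^L_{k|k-1} - P^L_k` of the innovation at time `k`. -/
def innovCov (S : LinearSystem n m) (k : ℕ) : Matrix (Fin n) (Fin n) ℝ :=
  S.priorCov k - S.postCov k

/-- The local prediction `x̂^L_{k|k-1}` of the sensor's Kalman filter. -/
def priorEst (S : LinearSystem n m) (N : Inputs Ω n m) : ℕ → Ω → EuclideanSpace ℝ (Fin n)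
  | 0, _ => S.initMean
  | k + 1, ω =>
      S.A.toEuclideanLin (S.priorEst N k ω +
        (S.gain k).toEuclideanLin (S.output N k ω - S.C.toEuclideanLin (S.priorEst N k ω)))

/-- The estimate innovation `z k = K^L_k (y k - C x̂^L_{k|k-1})`. -/
def innovation (S : LinearSystem n m) (N : Inputs Ω n m) (k : ℕ) (ω : Ω) :
    EuclideanSpace ℝ (Fin n) :=
  (S.gain k).toEuclideanLin (S.output N k ω - S.C.toEuclideanLin (S.priorEst N k ω))

/-- The local estimate `x̂^L_k` of the sensor's Kalman filter. -/
def localEst (S : LinearSystem n m) (N : Inputs Ω n m) (k : ℕ) (ω : Ω) :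
    EuclideanSpace ℝ (Fin n) :=
  S.priorEst N k ω + S.innovation N k ω

end LinearSystem

/-- `U` is orthogonal and `Uᵀ M U = diag(Λ, 0)`, where `Λ` lists `q` positive eigenvalues. -/
structure IsSpectralDecomposition (M U : Matrix (Fin n) (Fin n) ℝ) (Λ : Fin q → ℝ) : Prop where
  orthogonal : U ∈ Matrix.orthogonalGroup (Fin n) ℝ
  pos : ∀ a, 0 < Λ a
  diag : Uᵀ * M * U = Matrix.diagonal fun i : Fin n => if h : (i : ℕ) < q then Λ ⟨i, h⟩ else 0

/-- The normalizing matrix `F = [Λ^{-1/2}, 0] Uᵀ`. -/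
def normalizer (U : Matrix (Fin n) (Fin n) ℝ) (Λ : Fin q → ℝ) : Matrix (Fin q) (Fin n) ℝ :=
  (Matrix.of fun (a : Fin q) (i : Fin n) => if (i : ℕ) = a then (√(Λ a))⁻¹ else 0) * Uᵀ

/-- The normalized innovation `ε k = F k z k`. -/
def normInnovation (S : LinearSystem n m) (N : Inputs Ω n m)
    (U : ℕ → Matrix (Fin n) (Fin n) ℝ) (Λ : ℕ → Fin q → ℝ) (k : ℕ) (ω : Ω) :
    EuclideanSpace ℝ (Fin q) :=
  (normalizer (U k) (Λ k)).toEuclideanLin (S.innovation N k ω)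

/-- Given the thresholds `δ` and the path `ε` of normalized innovations, the time `t_k` of the
latest transmission strictly before time `k` (meaningful for `k ≥ 1`; time `0` always counts as a
transmission). The sum is the squared norm of the stacked vector `(ε (t_k + 1), …, ε k)`. -/
def lastTx (δ : ℕ → ℝ) (ε : ℕ → EuclideanSpace ℝ (Fin q)) : ℕ → ℕ
  | 0 => 0
  | k + 1 =>
      if δ k < ∑ i ∈ Finset.Ioc (lastTx δ ε k) k, ‖ε i‖ ^ 2 then k else lastTx δ ε k

/-- The decision `γ_k ∈ {0, 1}`: transmit at time `0`, and at time `k ≥ 1` if and only if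
`‖(ε (t_k + 1), …, ε k)‖² > δ k`. -/
def decision (δ : ℕ → ℝ) (ε : ℕ → EuclideanSpace ℝ (Fin q)) (k : ℕ) : ℝ :=
  if k = 0 ∨ δ k < ∑ i ∈ Finset.Ioc (lastTx δ ε k) k, ‖ε i‖ ^ 2 then 1 else 0

/-- `lastTx` is indeed `max {t < k : γ_t = 1}`. -/
theorem isGreatest_lastTx (δ : ℕ → ℝ) (ε : ℕ → EuclideanSpace ℝ (Fin q)) (k : ℕ) (hk : 1 ≤ k) :
    IsGreatest {t | t < k ∧ decision δ ε t = 1} (lastTx δ ε k) := by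
  induction k, hk using Nat.le_induction with
  | base =>
    have h0 : lastTx δ ε 1 = 0 := by simp [lastTx]
    rw [h0]
    exact ⟨⟨by omega, by simp [decision]⟩, fun t ht => by have := ht.1; omega⟩
  | succ k hk ih =>
    by_cases h : δ k < ∑ i ∈ Finset.Ioc (lastTx δ ε k) k, ‖ε i‖ ^ 2
    · have h1 : lastTx δ ε (k + 1) = k := by rw [lastTx, if_pos h]
      rw [h1]
      exact ⟨⟨by omega, by rw [decision, if_pos (Or.inr h)]⟩, fun t ht => by have := ht.1; omega⟩
    · have h1 : lastTx δ ε (k + 1) = lastTx δ ε k := by rw [lastTx, if_neg h]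
      rw [h1]
      refine ⟨⟨by have := ih.1.1; omega, ih.1.2⟩, fun t ht => ?_⟩
      obtain ⟨ht1, ht2⟩ := ht
      rcases Nat.lt_succ_iff_lt_or_eq.mp ht1 with hlt | rfl
      · exact ih.2 ⟨hlt, ht2⟩
      · have h3 : ¬ (t = 0 ∨ δ t < ∑ i ∈ Finset.Ioc (lastTx δ ε t) t, ‖ε i‖ ^ 2) := by
          rintro (h4 | h4)
          · omega
          · exact h h4
        rw [decision, if_neg h3] at ht2
        exact absurd ht2 (by norm_num)

/-- The σ-algebra generated by the remote center's information `γ_j x̂^L_j, γ_j`, `0 ≤ j ≤ k`. -/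
abbrev infoSigma (γ : ℕ → Ω → ℝ) (xL : ℕ → Ω → EuclideanSpace ℝ (Fin n)) (k : ℕ) :
    MeasurableSpace Ω :=
  MeasurableSpace.comap (fun ω (j : Fin (k + 1)) => (γ j ω • xL j ω, γ j ω)) inferInstance

/-- The MMSE estimate `E[x | 𝓘]`. -/
def mmseEst (𝓘 : MeasurableSpace Ω) [MeasurableSpace Ω] (μ : Measure Ω)
    (x : Ω → EuclideanSpace ℝ (Fin n)) : Ω → EuclideanSpace ℝ (Fin n) :=
  μ[x | 𝓘]

/-- The conditional error covariance `E[(x - x̂)(x - x̂)ᵀ | 𝓘]` of `x̂ = E[x | 𝓘]`. -/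
def mmseCov (𝓘 : MeasurableSpace Ω) [MeasurableSpace Ω] (μ : Measure Ω)
    (x : Ω → EuclideanSpace ℝ (Fin n)) (ω : Ω) : Matrix (Fin n) (Fin n) ℝ :=
  Matrix.of fun a b =>
    (μ[fun ω' => (x ω' - mmseEst 𝓘 μ x ω') a * (x ω' - mmseEst 𝓘 μ x ω') b | 𝓘]) ω

/-- The density of the chi-square distribution with `q` degrees of freedom. -/
def chiSqPDF (q : ℕ) (u : ℝ) : ℝ := gammaPDFReal ((q : ℝ) / 2) (1 / 2) u

/-- The nested integral `∫_{D_l} g l u_l f(u_l; q) du_l ⋯ ∫_{D_{l+r-1}} g ⋯ f(⋯; q) du_{l+r-1}`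
over `r` variables, where `D_j = [0, δ j - ∑_{h<j} u_h]` and `s` is the sum of the variables before
`u_l`. An empty interval contributes `0`. -/
def truncInt (q : ℕ) (δ : ℕ → ℝ) (g : ℕ → ℝ → ℝ) : (r l : ℕ) → (s : ℝ) → ℝ
  | 0, _, _ => 1
  | r + 1, l, s =>
      ∫ u in Set.Icc 0 (δ l - s), g l u * chiSqPDF q u * truncInt q δ g r (l + 1) (s + u)

/-- The weight `η_i(δ_{t+1}, …, δ_k)`: `1 / q` times the ratio of the truncated chi-square
integrals over `u_{t+1}, …, u_k`, with the factor `u_i` in the numerator. -/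
def eta (q : ℕ) (δ : ℕ → ℝ) (t k i : ℕ) : ℝ :=
  1 / (q : ℝ) * (truncInt q δ (fun l u => if l = i then u else 1) (k - t) (t + 1) 0 /
    truncInt q δ (fun _ _ => 1) (k - t) (t + 1) 0)

end RemoteEstimation

end

open RemoteEstimation

/-! Let $t$ be the latest transmission time up to and including $k$. Unrolling the sensor's filter
gives $x_k = A^{k-t}\hat x^L_t + D_{t,k}$, where $D_{t,k}$ is the filtering error at $k$ plus
$\sum_{i=t+1}^{k} A^{k-i} z_i$ (`LinearSystem.state_eq_add_predErr`). The innovations $z_i$ are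
independent centered Gaussians with covariance $P^L_{i|i-1}-P^L_i$, and the filtering error at $k$
is a centered Gaussian with covariance $P^L_k$, independent of $z_0,\dots,z_k$. Both facts come from
an induction along the filter (`LinearSystem.measurement_update`,
`Inputs.IsGaussianWhite.priorErr`).

On the event that the last transmission was at $t$, every event observable by the center is an event
of $z_0,\dots,z_t$ intersected with the silence event, which depends only on $z_{t+1},\dots,z_k$
(`exists_past_inter_silentPath`). Since $D_{t,k}$ is independent of $z_0,\dots,z_t$, conditioning on
the information amounts to averaging over the silence event (`condExp_predErr`).

These averages follow from symmetry. Almost surely $z_i = B_i\epsilon_i$ with i.i.d. standard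
Gaussian $\epsilon_i$, and silence restricts only the norms $\|\epsilon_i\|$, so it is invariant
under an orthogonal map applied to a single $\epsilon_i$. Reflections kill first moments and mixed
second moments; coordinate swaps make the remaining second moments of $\epsilon_i$ equal, hence
$1/q$ times the average of $\|\epsilon_i\|^2$. The squared norms are independent chi-square
variables, so Fubini identifies this number as $\eta_i$ (`setIntegral_silentEvent_coord_mul`). Thus
$D_{t,k}$ has conditional mean zero and the claimed conditional covariance (`setIntegral_predErr`).
-/

noncomputable section

namespace RemoteEstimation

/-! ### The squared norm of a standard Gaussian vector is chi-square -/

theorem integral_exp_mul_sq_gaussianReal (t : ℝ) :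
    ∫ x, Real.exp (t * x ^ 2) ∂(gaussianReal 0 1) = √((1 / 2) / (1 / 2 - t)) := by
  rw [integral_gaussianReal_eq_integral_smul one_ne_zero]
  have h1 : ∀ x : ℝ, gaussianPDFReal 0 1 x • Real.exp (t * x ^ 2) =
      (√(2 * Real.pi))⁻¹ * Real.exp (-(1 / 2 - t) * x ^ 2) := by
    intro x
    rw [gaussianPDFReal, smul_eq_mul, mul_assoc, ← Real.exp_add]
    simp only [NNReal.coe_one, mul_one, sub_zero]
    congr 2
    ring
  simp_rw [h1]
  -- No restriction on `t` is needed: for `t ≥ 1/2` the divergent integral is `0` by convention, and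
  -- so is the square root on the right.
  rw [integral_const_mul, integral_gaussian, ← Real.sqrt_inv, ← Real.sqrt_mul (by positivity)]
  congr 1
  field_simp

theorem integral_gammaMeasure {a r : ℝ} (ha : 0 < a) (hr : 0 < r) (f : ℝ → ℝ) :
    ∫ x, f x ∂(gammaMeasure a r) = ∫ x in Set.Ioi 0, gammaPDFReal a r x * f x := by
  rw [gammaMeasure, integral_withDensity_eq_integral_toReal_smul
    (by unfold gammaPDF; fun_prop) (by simp [gammaPDF]), ← integral_Ici_eq_integral_Ioi,
    ← integral_indicator measurableSet_Ici]
  refine integral_congr_ae (ae_of_all _ fun x => ?_)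
  by_cases hx : 0 ≤ x
  · simp [Set.indicator, hx, gammaPDF, gammaPDFReal_nonneg ha hr x]
  · simp [Set.indicator, hx, gammaPDF, gammaPDFReal]

theorem mgf_gammaMeasure {a r : ℝ} (ha : 0 < a) (hr : 0 < r) (t : ℝ) :
    mgf id (gammaMeasure a r) t = if t < r then (r / (r - t)) ^ a else 0 := by
  rw [mgf, integral_gammaMeasure ha hr]
  have h1 : ∀ x ∈ Set.Ioi (0 : ℝ), gammaPDFReal a r x * Real.exp (t * id x) =
      r ^ a / Real.Gamma a * (x ^ (a - 1) * Real.exp (-((r - t) * x))) := by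
    intro x hx
    rw [gammaPDFReal, if_pos (le_of_lt hx), mul_assoc, mul_assoc, ← Real.exp_add, id]
    congr 3
    ring
  have hG := Real.Gamma_pos_of_pos ha
  rw [setIntegral_congr_fun measurableSet_Ioi h1, integral_const_mul]
  split_ifs with ht
  · rw [Real.integral_rpow_mul_exp_neg_mul_Ioi ha (by linarith),
      Real.div_rpow zero_le_one (by linarith), Real.div_rpow hr.le (by linarith)]
    simp
    field_simp
  -- For `t ≥ r` the exponential is at least `1`, so integrability would pass to a pure power, which
  -- is never integrable on all of `(0, ∞)`.
  · rw [integral_undef, mul_zero]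
    intro h
    refine not_integrableOn_Ioi_rpow (a - 1) (h.mono' (by fun_prop) ?_)
    refine (ae_restrict_iff' measurableSet_Ioi).2 (ae_of_all _ fun x (hx : 0 < x) => ?_)
    rw [Real.norm_of_nonneg (by positivity)]
    refine le_mul_of_one_le_right (by positivity) (Real.one_le_exp ?_)
    nlinarith

/-- The moment generating functions agree at every real argument, including those where both are `0`
for lack of integrability. Analytic continuation from a neighbourhood of `0` to the imaginary axis
then gives equal characteristic functions. -/
theorem map_norm_sq_stdGaussian {q : ℕ} (hq : 0 < q) :
    (stdGaussian (EuclideanSpace ℝ (Fin q))).map (fun x => ‖x‖ ^ 2) =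
      gammaMeasure ((q : ℝ) / 2) (1 / 2) := by
  have ha : 0 < (q : ℝ) / 2 := by positivity
  have := isProbabilityMeasure_gammaMeasure (r := 1 / 2) ha (by norm_num)
  have := Measure.isProbabilityMeasure_map (μ := stdGaussian (EuclideanSpace ℝ (Fin q)))
    (f := fun x => ‖x‖ ^ 2) (by fun_prop)
  have hgamma := mgf_gammaMeasure (r := 1 / 2) ha (by norm_num)
  have hmgf : mgf id (gammaMeasure ((q : ℝ) / 2) (1 / 2)) =
      mgf id ((stdGaussian (EuclideanSpace ℝ (Fin q))).map (fun x => ‖x‖ ^ 2)) := by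
    ext t
    rw [hgamma, mgf,
      integral_map (by fun_prop) (by fun_prop), ← map_pi_eq_stdGaussian,
      integral_map (by fun_prop) (by fun_prop)]
    have h1 : ∀ x : Fin q → ℝ, Real.exp (t * id (‖WithLp.toLp 2 x‖ ^ 2)) =
        ∏ i, Real.exp (t * x i ^ 2) := by
      intro x
      rw [id, EuclideanSpace.real_norm_sq_eq, ← Real.exp_sum, Finset.mul_sum]
    simp_rw [h1]
    rw [integral_fintype_prod_eq_pow (fun x : ℝ => Real.exp (t * x ^ 2)),
      integral_exp_mul_sq_gaussianReal, Fintype.card_fin]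
    split_ifs with ht
    · rw [Real.sqrt_eq_rpow, ← Real.rpow_mul_natCast (div_nonneg (by norm_num) (by linarith))]
      congr 1
      ring
    · rw [Real.sqrt_eq_zero_of_nonpos, zero_pow hq.ne']
      exact div_nonpos_of_nonneg_of_nonpos (by norm_num) (by linarith)
  refine (Measure.ext_of_charFun (funext fun t => ?_)).symm
  rw [← complexMGF_id_mul_I, ← complexMGF_id_mul_I]
  refine eqOn_complexMGF_of_mgf hmgf ?_
  suffices h : Set.Iio (1 / 2) ⊆ integrableExpSet id (gammaMeasure ((q : ℝ) / 2) (1 / 2)) by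
    simpa using interior_mono h (by simp : (0 : ℝ) ∈ interior (Set.Iio (1 / 2)))
  intro s hs
  -- A non-integrable exponential would make the moment generating function `0`, whereas the
  -- explicit formula is positive below `1/2`.
  by_contra hc
  have h0 := hgamma s
  rw [mgf_undef hc, if_pos (Set.mem_Iio.1 hs)] at h0
  exact absurd h0 (Real.rpow_pos_of_pos (div_pos (by norm_num) (sub_pos.2 hs)) _).ne

/-! ### Nested truncated integrals as integrals over a product measure -/

/-- The event that the partial sums of `u`, started from `s`, respect the thresholds
`δ l, δ (l + 1), …`. -/
def silentSet (δ : ℕ → ℝ) (r l : ℕ) (s : ℝ) : Set (Fin r → ℝ) :=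
  {u | ∀ j : Fin r, s + ∑ h ∈ Finset.Iic j, u h ≤ δ (l + j)}

theorem measurableSet_silentSet (δ : ℕ → ℝ) (r l : ℕ) (s : ℝ) :
    MeasurableSet (silentSet δ r l s) := by
  have : silentSet δ r l s =
      ⋂ j : Fin r, {u | s + ∑ h ∈ Finset.Iic j, u h ≤ δ (l + j)} := by
    ext; simp [silentSet]
  rw [this]
  exact MeasurableSet.iInter fun j => measurableSet_le (by fun_prop) (by fun_prop)

/-- Splitting off the first variable mirrors the recursion that defines `truncInt`. -/
theorem cons_mem_silentSet (δ : ℕ → ℝ) (r l : ℕ) (s x : ℝ) (u : Fin r → ℝ) :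
    (Fin.cons x u : Fin (r + 1) → ℝ) ∈ silentSet δ (r + 1) l s ↔
      s + x ≤ δ l ∧ u ∈ silentSet δ r (l + 1) (s + x) := by
  have h0 : Finset.Iic (0 : Fin (r + 1)) = {0} := by ext i; simp
  have hs : ∀ j : Fin r, ∑ h ∈ Finset.Iic j.succ, (Fin.cons x u : Fin (r + 1) → ℝ) h =
      x + ∑ h ∈ Finset.Iic j, u h := by
    intro j
    have h1 : Finset.Iic j.succ = Finset.univ.filter fun h => h ≤ j.succ := by ext; simp
    have h2 : Finset.Iic j = Finset.univ.filter fun h => h ≤ j := by ext; simp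
    simp [h1, h2, Finset.sum_filter, Fin.sum_univ_succ]
  simp only [silentSet, Set.mem_ofPred_eq, Fin.forall_fin_succ, h0, Finset.sum_singleton,
    Fin.cons_zero, hs, Fin.val_succ, Fin.val_zero, add_zero, ← add_assoc]
  simp only [add_right_comm l]

/-- Fubini, one variable at a time. The constraint supplies the upper end of each interval of
integration, and the support of the chi-square law supplies the lower end `0`. -/
theorem integral_silentSet_eq_truncInt {q : ℕ} (hq : 0 < q) (δ : ℕ → ℝ) (g : ℕ → ℝ → ℝ)
    (hg : ∀ l, Integrable (g l) (gammaMeasure ((q : ℝ) / 2) (1 / 2))) (r l : ℕ) (s : ℝ) :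
    ∫ u in silentSet δ r l s, ∏ j : Fin r, g (l + j) (u j)
        ∂(Measure.pi fun _ : Fin r => gammaMeasure ((q : ℝ) / 2) (1 / 2)) =
      truncInt q δ g r l s := by
  have ha : 0 < (q : ℝ) / 2 := by positivity
  have := isProbabilityMeasure_gammaMeasure (r := 1 / 2) ha (by norm_num)
  set ν := gammaMeasure ((q : ℝ) / 2) (1 / 2) with hν
  induction r generalizing l s with
  | zero =>
    have : silentSet δ 0 l s = Set.univ := by ext; simp [silentSet]
    simp [truncInt, this]
  | succ r ih =>
    let E : ℝ × (Fin r → ℝ) ≃ᵐ (Fin (r + 1) → ℝ) :=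
      (MeasurableEquiv.piFinSuccAbove (fun _ => ℝ) 0).symm
    have e : MeasurePreserving E (ν.prod (Measure.pi fun _ => ν)) (Measure.pi fun _ => ν) :=
      (measurePreserving_piFinSuccAbove (fun _ : Fin (r + 1) => ν) 0).symm
    have h0 : ∀ x (u : Fin r → ℝ), E (x, u) =
      (Fin.cons x u : Fin (r + 1) → ℝ) := fun x u => by
        simp [E, MeasurableEquiv.piFinSuccAbove]; rfl
    rw [← integral_indicator (measurableSet_silentSet ..), ← e.integral_comp', integral_prod]
    · have : ∀ x, ∫ u, (silentSet δ (r + 1) l s).indicator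
            (fun u => ∏ j : Fin (r + 1), g (l + j) (u j)) (E (x, u)) ∂(Measure.pi fun _ => ν) =
          (Set.Iic (δ l - s)).indicator (fun x => g l x * truncInt q δ g r (l + 1) (s + x)) x := by
        intro x
        simp_rw [h0]
        simp_rw [← ih, ← integral_indicator (measurableSet_silentSet δ r (l + 1) _)]
        have hi : ∀ u : Fin r → ℝ, (silentSet δ (r + 1) l s).indicator
            (fun u => ∏ j : Fin (r + 1), g (l + j) (u j)) (Fin.cons x u) =
            (Set.Iic (δ l - s)).indicator
              (fun x => g l x * (silentSet δ r (l + 1) (s + x)).indicator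
              (fun u => ∏ j : Fin r, g (l + 1 + j) (u j)) u) x := by
          intro u
          have hc := cons_mem_silentSet δ r l s x u
          have hx : x ∈ Set.Iic (δ l - s) ↔ s + x ≤ δ l := by
            rw [Set.mem_Iic, le_sub_iff_add_le, add_comm]
          by_cases h1 : s + x ≤ δ l
          · rw [Set.indicator_of_mem (hx.2 h1)]
            by_cases h2 : u ∈ silentSet δ r (l + 1) (s + x)
            · rw [Set.indicator_of_mem (hc.2 ⟨h1, h2⟩), Set.indicator_of_mem h2]
              simp [Fin.prod_univ_succ, add_assoc, add_comm 1]
            · rw [Set.indicator_of_notMem (fun h => h2 (hc.1 h).2), Set.indicator_of_notMem h2,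
                mul_zero]
          · rw [Set.indicator_of_notMem (fun h => h1 (hx.1 h)),
              Set.indicator_of_notMem (fun h => h1 (hc.1 h).1)]
        simp_rw [hi]
        by_cases hx : x ∈ Set.Iic (δ l - s)
        · simp only [Set.indicator_of_mem hx, integral_const_mul]
        · simp only [Set.indicator_of_notMem hx, integral_zero]
      simp_rw [this]
      rw [integral_gammaMeasure ha (by norm_num), ← integral_Ici_eq_integral_Ioi, truncInt,
        ← integral_indicator measurableSet_Ici, ← integral_indicator measurableSet_Icc]
      congr 1 with x
      simp only [Set.indicator, Set.mem_Iic, Set.mem_Ici, Set.mem_Icc, chiSqPDF]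
      by_cases h1 : 0 ≤ x <;> by_cases h2 : x ≤ δ l - s <;> simp [h1, h2] <;> ring
    · exact (e.integrable_comp_emb (MeasurableEquiv.measurableEmbedding _)).2 <|
        (Integrable.fintype_prod fun j : Fin (r + 1) => hg (l + j)).indicator
        (measurableSet_silentSet ..)

/-! ### Gaussian moments on the silence event, by symmetry -/

/-- The event that the accumulated squared norms of `u` respect the thresholds
`δ l, δ (l + 1), …`. -/
def silentEvent {q : ℕ} (δ : ℕ → ℝ) (r l : ℕ) : Set (Fin r → EuclideanSpace ℝ (Fin q)) :=
  (fun u j => ‖u j‖ ^ 2) ⁻¹' silentSet δ r l 0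

section

variable {q r l : ℕ} {δ : ℕ → ℝ}

theorem measurableSet_silentEvent :
    MeasurableSet (silentEvent δ r l : Set (Fin r → EuclideanSpace ℝ (Fin q))) :=
  (measurableSet_silentSet δ r l 0).preimage (by fun_prop)

/-- Product of `r` standard Gaussian measures. -/
abbrev piGaussian (q r : ℕ) : Measure (Fin r → EuclideanSpace ℝ (Fin q)) :=
  Measure.pi fun _ => stdGaussian (EuclideanSpace ℝ (Fin q))

/-- A linear isometry acting on one block preserves the standard Gaussian law and all the norms,
hence both the product measure and the event. -/
theorem setIntegral_silentEvent_update (i : Fin r)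
    (f : EuclideanSpace ℝ (Fin q) ≃ₗᵢ[ℝ] EuclideanSpace ℝ (Fin q))
    {g : (Fin r → EuclideanSpace ℝ (Fin q)) → ℝ} (hg : Measurable g) :
    ∫ u in silentEvent δ r l, g (Function.update u i (f (u i))) ∂(piGaussian q r) =
      ∫ u in silentEvent δ r l, g u ∂(piGaussian q r) := by
  let φ : Fin r → (EuclideanSpace ℝ (Fin q) ≃ₗᵢ[ℝ] EuclideanSpace ℝ (Fin q)) :=
    fun j => if j = i then f else LinearIsometryEquiv.refl ℝ _
  have hT : MeasurePreserving (fun u j => φ j (u j)) (piGaussian q r) (piGaussian q r) :=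
    measurePreserving_pi _ _ fun j => ⟨(φ j).continuous.measurable, stdGaussian_map (φ j)⟩
  have hu : ∀ u, Function.update u i (f (u i)) = fun j => φ j (u j) := by
    intro u
    ext1 j
    by_cases h : j = i
    · subst h; simp [φ]
    · simp [φ, h]
  have hs : ∀ u, (fun j => φ j (u j)) ∈ (silentEvent δ r l : Set _) ↔
      u ∈ (silentEvent δ r l : Set (Fin r → EuclideanSpace ℝ (Fin q))) := by
    intro u
    simp [silentEvent]
  have hm := measurableSet_silentEvent (q := q) (δ := δ) (r := r) (l := l)
  rw [← integral_indicator hm, ← integral_indicator hm]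
  conv_rhs => rw [← hT.map_eq]
  rw [integral_map hT.measurable.aemeasurable (hg.indicator hm).aestronglyMeasurable]
  refine integral_congr_ae (ae_of_all _ fun u => ?_)
  dsimp only
  by_cases h : u ∈ (silentEvent δ r l : Set (Fin r → EuclideanSpace ℝ (Fin q)))
  · rw [Set.indicator_of_mem h, Set.indicator_of_mem ((hs u).2 h), hu]
  · rw [Set.indicator_of_notMem h, Set.indicator_of_notMem fun h' => h ((hs u).1 h')]

/-- The reflection of the `c`-th coordinate. -/
def reflectCoord (c : Fin q) : EuclideanSpace ℝ (Fin q) ≃ₗᵢ[ℝ] EuclideanSpace ℝ (Fin q) :=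
  LinearIsometryEquiv.piLpCongrRight 2
    fun d => if d = c then LinearIsometryEquiv.neg ℝ else LinearIsometryEquiv.refl ℝ ℝ

theorem reflectCoord_apply (c d : Fin q) (x : EuclideanSpace ℝ (Fin q)) :
    reflectCoord c x d = if d = c then -x d else x d := by
  simp only [reflectCoord, LinearIsometryEquiv.piLpCongrRight_apply]
  split_ifs <;> simp_all

/-- Reflecting the coordinate shows that the integral equals its own negative. -/
theorem setIntegral_silentEvent_coord (i : Fin r) (c : Fin q) :
    ∫ u in silentEvent δ r l, u i c ∂(piGaussian q r) = 0 := by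
  have := setIntegral_silentEvent_update (δ := δ) (l := l) i (reflectCoord c)
    (g := fun u => u i c) (by fun_prop)
  simp only [Function.update_self, reflectCoord_apply, if_true, integral_neg] at this
  linarith

/-- Reflecting coordinate `c` of block `i` changes the sign of the first factor only, because the
second factor lies in another block or another coordinate. -/
theorem setIntegral_silentEvent_coord_mul_of_ne {i j : Fin r} {c d : Fin q}
    (h : ¬(i = j ∧ c = d)) :
    ∫ u in silentEvent δ r l, u i c * u j d ∂(piGaussian q r) = 0 := by
  have := setIntegral_silentEvent_update (δ := δ) (l := l) i (reflectCoord c)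
    (g := fun u => u i c * u j d) (by fun_prop)
  have h1 : ∀ u : Fin r → EuclideanSpace ℝ (Fin q),
      Function.update u i (reflectCoord c (u i)) j d = u j d := by
    intro u
    by_cases hij : j = i
    · subst hij
      have : d ≠ c := fun hdc => h ⟨rfl, hdc.symm⟩
      simp [reflectCoord_apply, this]
    · simp [hij]
  simp only [h1, Function.update_self, reflectCoord_apply, if_true, neg_mul, integral_neg] at this
  linarith

theorem integrable_norm_sq_piGaussian (i : Fin r) :
    Integrable (fun u : Fin r → EuclideanSpace ℝ (Fin q) => ‖u i‖ ^ 2) (piGaussian q r) :=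
  integrable_comp_eval (μ := fun _ : Fin r => stdGaussian (EuclideanSpace ℝ (Fin q)))
    (f := fun x => ‖x‖ ^ 2) (IsGaussian.memLp_two_id.integrable_norm_pow (by simp))

theorem integrable_coord_sq_piGaussian (i : Fin r) (c : Fin q) :
    Integrable (fun u : Fin r → EuclideanSpace ℝ (Fin q) => u i c ^ 2) (piGaussian q r) := by
  refine (integrable_norm_sq_piGaussian i).mono' (Measurable.aestronglyMeasurable (by fun_prop))
    (ae_of_all _ fun u => ?_)
  rw [Real.norm_of_nonneg (sq_nonneg _), ← sq_abs (u i c)]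
  gcongr
  exact PiLp.norm_apply_le (u i) c

/-- Swapping two coordinates is an isometry, so all `q` coordinates contribute equally to the
integral of the squared norm. -/
theorem setIntegral_silentEvent_coord_sq (i : Fin r) (c : Fin q) :
    ∫ u in silentEvent δ r l, u i c ^ 2 ∂(piGaussian q r) =
      1 / (q : ℝ) * ∫ u in silentEvent δ r l, ‖u i‖ ^ 2 ∂(piGaussian q r) := by
  have hq : (q : ℝ) ≠ 0 := by have := c.pos; positivity
  have h1 : ∀ d, ∫ u in silentEvent δ r l, u i d ^ 2 ∂(piGaussian q r) =
      ∫ u in silentEvent δ r l, u i c ^ 2 ∂(piGaussian q r) := by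
    intro d
    rw [← setIntegral_silentEvent_update i
      (LinearIsometryEquiv.piLpCongrLeft 2 ℝ ℝ (Equiv.swap c d)) (g := fun u => u i d ^ 2)
      (by fun_prop)]
    simp
  simp_rw [EuclideanSpace.real_norm_sq_eq]
  rw [integral_finsetSum _ fun d _ => (integrable_coord_sq_piGaussian i d).integrableOn]
  simp [h1]
  field_simp

theorem measurePreserving_norm_sq_piGaussian (hq : 0 < q) :
    MeasurePreserving (fun (u : Fin r → EuclideanSpace ℝ (Fin q)) j => ‖u j‖ ^ 2)
      (piGaussian q r) (Measure.pi fun _ => gammaMeasure ((q : ℝ) / 2) (1 / 2)) := by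
  have := isProbabilityMeasure_gammaMeasure (a := (q : ℝ) / 2) (r := 1 / 2) (by positivity)
    (by norm_num)
  exact measurePreserving_pi _ _ fun j => ⟨by fun_prop, map_norm_sq_stdGaussian hq⟩

theorem integrable_id_gammaMeasure (hq : 0 < q) :
    Integrable (fun u => u) (gammaMeasure ((q : ℝ) / 2) (1 / 2)) := by
  rw [← map_norm_sq_stdGaussian hq, integrable_map_measure (by fun_prop) (by fun_prop)]
  exact IsGaussian.memLp_two_id.integrable_norm_pow (by simp)

theorem setIntegral_silentEvent_prod (hq : 0 < q) (g : ℕ → ℝ → ℝ)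
    (hg : ∀ l, Integrable (g l) (gammaMeasure ((q : ℝ) / 2) (1 / 2)))
      (hgm : ∀ l, Measurable (g l)) :
    ∫ u in silentEvent δ r l, ∏ j : Fin r, g (l + j) (‖u j‖ ^ 2) ∂(piGaussian q r) =
      truncInt q δ g r l 0 := by
  have hT := measurePreserving_norm_sq_piGaussian (r := r) hq
  rw [← integral_silentSet_eq_truncInt hq δ g hg, ← hT.map_eq, setIntegral_map
    (measurableSet_silentSet ..) _ hT.measurable.aemeasurable]
  · rfl
  · exact
    (Finset.measurable_prod _ fun j _ => (hgm _).comp (measurable_pi_apply j)).aestronglyMeasurable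

theorem setIntegral_silentEvent_coord_mul {t : ℕ} (i j : Fin r) (c d : Fin q) :
    ∫ u in silentEvent δ r (t + 1), u i c * u j d ∂(piGaussian q r) =
      (if i = j ∧ c = d then eta q δ t (t + r) (t + 1 + i) else 0) *
        (piGaussian q r).real (silentEvent δ r (t + 1)) := by
  have hq : 0 < q := c.pos
  have := isProbabilityMeasure_gammaMeasure (a := (q : ℝ) / 2) (r := 1 / 2) (by positivity)
    (by norm_num)
  split_ifs with h
  · obtain ⟨rfl, rfl⟩ := h
    have h1 : truncInt q δ (fun _ _ => 1) r (t + 1) 0 =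
        (piGaussian q r).real (silentEvent δ r (t + 1)) := by
      rw [← setIntegral_silentEvent_prod hq _ (fun _ => integrable_const _) (by fun_prop)]
      simp
    have h2 : truncInt q δ (fun l u => if l = t + 1 + i then u else 1) r (t + 1) 0 =
        ∫ u in silentEvent δ r (t + 1), ‖u i‖ ^ 2 ∂(piGaussian q r) := by
      rw [← setIntegral_silentEvent_prod hq]
      · congr 1 with u
        simp [Fin.val_inj]
      · intro l
        split_ifs
        · exact integrable_id_gammaMeasure hq
        · exact integrable_const _
      · intro l
        split_ifs <;> fun_prop
    simp only [← pow_two]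
    rw [setIntegral_silentEvent_coord_sq, eta, Nat.add_sub_cancel_left, h1, h2, mul_assoc]
    congr 1
    -- If silence has probability zero, the quotient in `eta` is a division by `0`; the identity
    -- survives because the integral over a null set vanishes too.
    by_cases h0 : (piGaussian q r).real (silentEvent δ r (t + 1)) = 0
    · rw [h0, mul_zero, setIntegral_measure_zero]
      rwa [measureReal_eq_zero_iff] at h0
    · rw [div_mul_cancel₀ _ h0]
  · rw [setIntegral_silentEvent_coord_mul_of_ne h, zero_mul]

end

/-! ### Combinatorics and measurability of the trigger -/

section

variable {Ω : Type*} {q : ℕ} {δ : ℕ → ℝ}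

theorem lastTx_lt (δ : ℕ → ℝ) (ε : ℕ → EuclideanSpace ℝ (Fin q)) {k : ℕ} (hk : 1 ≤ k) :
    lastTx δ ε k < k := (isGreatest_lastTx δ ε k hk).1.1

theorem decision_ne_one_iff (ε : ℕ → EuclideanSpace ℝ (Fin q)) {k : ℕ} (hk : 1 ≤ k) :
    decision δ ε k ≠ 1 ↔ ∑ i ∈ Finset.Ioc (lastTx δ ε k) k, ‖ε i‖ ^ 2 ≤ δ k := by
  rw [decision]
  split_ifs with h
  · simp only [ne_eq, not_true_eq_false, false_iff, not_le]
    rcases h with h | h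
    · omega
    · exact h
  · simp only [ne_eq, zero_ne_one, not_false_eq_true, true_iff]
    exact not_lt.1 fun h' => h (Or.inr h')

theorem decision_eq_zero_of_ne_one {ε : ℕ → EuclideanSpace ℝ (Fin q)} {k : ℕ}
    (h : decision δ ε k ≠ 1) : decision δ ε k = 0 := by
  rw [decision] at h ⊢
  split_ifs at h ⊢ <;> simp_all

theorem lastTx_succ (ε : ℕ → EuclideanSpace ℝ (Fin q)) (k : ℕ) :
    lastTx δ ε (k + 1) = if decision δ ε k = 1 then k else lastTx δ ε k := by
  rw [lastTx, decision]
  rcases k with _ | k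
  · simp [lastTx]
  · by_cases h : δ (k + 1) < ∑ i ∈ Finset.Ioc (lastTx δ ε (k + 1)) (k + 1), ‖ε i‖ ^ 2 <;> simp [h]

theorem lastTx_succ_eq_iff_decision (ε : ℕ → EuclideanSpace ℝ (Fin q)) (k t : ℕ) :
    lastTx δ ε (k + 1) = t ↔ t ≤ k ∧ decision δ ε t = 1 ∧
      ∀ j ∈ Finset.Ioc t k, decision δ ε j ≠ 1 := by
  have hg := isGreatest_lastTx δ ε (k + 1) (by omega)
  constructor
  · rintro rfl
    refine ⟨by have := hg.1.1; omega, hg.1.2, fun j hj hd => ?_⟩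
    rw [Finset.mem_Ioc] at hj
    have : j ≤ _ := hg.2 ⟨by omega, hd⟩
    omega
  · rintro ⟨h1, h2, h3⟩
    refine hg.unique ⟨⟨by omega, h2⟩, fun j hj => ?_⟩
    by_contra hlt
    exact h3 j (Finset.mem_Ioc.2 ⟨by omega, by have := hj.1; omega⟩) hj.2

/-- The latest transmission up to time `k` took place at time `t` iff time `t` transmits and the
accumulated innovations since then respect the thresholds. -/
theorem lastTx_succ_eq_iff (ε : ℕ → EuclideanSpace ℝ (Fin q)) {k t : ℕ} (htk : t ≤ k) :
    lastTx δ ε (k + 1) = t ↔ decision δ ε t = 1 ∧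
      ∀ j ∈ Finset.Ioc t k, ∑ i ∈ Finset.Ioc t j, ‖ε i‖ ^ 2 ≤ δ j := by
  induction k, htk using Nat.le_induction with
  | base => rw [lastTx_succ_eq_iff_decision]; simp
  | succ k htk ih =>
    have hI : Finset.Ioc t (k + 1) = insert (k + 1) (Finset.Ioc t k) := by
      ext; simp only [Finset.mem_Ioc, Finset.mem_insert]; omega
    rw [lastTx_succ, hI, Finset.forall_mem_insert]
    split_ifs with h
    -- If time `k + 1` transmits, the right side must fail: the thresholds up to `k` place the
    -- previous transmission at `t` by induction, and the bound at `k + 1` would then forbid this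
    -- one.
    · refine iff_of_false (by omega) ?_
      rintro ⟨h1, h2, h3⟩
      have := ih.2 ⟨h1, h3⟩
      rw [← this] at h2
      exact (decision_ne_one_iff ε (by omega)).2 h2 h
    · rw [ih]
      refine ⟨fun h' => ⟨h'.1, ?_, h'.2⟩, fun h' => ⟨h'.1, h'.2.2⟩⟩
      have := (decision_ne_one_iff ε (by omega)).1 h
      rwa [ih.2 h'] at this

theorem forall_Ioc_iff_mem_silentEvent (ε : ℕ → EuclideanSpace ℝ (Fin q)) (t r : ℕ) :
    (∀ j ∈ Finset.Ioc t (t + r), ∑ i ∈ Finset.Ioc t j, ‖ε i‖ ^ 2 ≤ δ j) ↔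
      (fun i : Fin r => ε (t + 1 + i)) ∈ (silentEvent δ r (t + 1) : Set _) := by
  have hsum : ∀ j : Fin r, ∑ h ∈ Finset.Iic j, ‖ε (t + 1 + h)‖ ^ 2 =
      ∑ i ∈ Finset.Ioc t (t + 1 + j), ‖ε i‖ ^ 2 := by
    intro j
    refine Finset.sum_bij (fun h _ => t + 1 + (h : ℕ)) ?_ ?_ ?_ ?_
    · intro h hh
      have : (h : ℕ) ≤ j := by simpa using hh
      simp only [Finset.mem_Ioc]; omega
    · intro a _ b _ hab
      ext; omega
    · intro b hb
      rw [Finset.mem_Ioc] at hb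
      refine ⟨⟨b - (t + 1), by omega⟩, ?_, by simp; omega⟩
      rw [Finset.mem_Iic, Fin.le_def]; simp; omega
    · simp
  simp only [silentEvent, silentSet, Set.mem_preimage, Set.mem_ofPred_eq, zero_add, hsum,
    Finset.mem_Ioc]
  constructor
  · intro h j
    exact h _ ⟨by omega, by omega⟩
  · intro h j hj
    have := h ⟨j - (t + 1), by omega⟩
    simpa [Nat.add_sub_cancel' (show t + 1 ≤ j by omega)] using this

variable {m : MeasurableSpace Ω} {ε : ℕ → Ω → EuclideanSpace ℝ (Fin q)}

/-- The two claims feed each other and need a joint induction. The σ-algebra is arbitrary, so that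
it can also be the one generated by the past. -/
theorem measurable_lastTx_decision {k : ℕ} (hε : ∀ i ≤ k, Measurable (ε i)) :
    Measurable (fun ω => lastTx δ (fun i => ε i ω) k) ∧
      Measurable (fun ω => decision δ (fun i => ε i ω) k) := by
  induction k with
  | zero => simp [lastTx, decision]
  | succ k ih =>
    obtain ⟨h1, h2⟩ := ih fun i hi => hε i (by omega)
    have h3 : Measurable fun ω => lastTx δ (fun i => ε i ω) (k + 1) := by
      simp only [lastTx_succ]
      exact Measurable.ite (h2 (measurableSet_singleton 1)) measurable_const h1
    refine ⟨h3, ?_⟩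
    -- A sum over a random index range becomes a sum over a fixed range of terms switched on by
    -- measurable events.
    have h4 : ∀ ω, ∑ i ∈ Finset.Ioc (lastTx δ (fun i => ε i ω) (k + 1)) (k + 1), ‖ε i ω‖ ^ 2 =
        ∑ i ∈ Finset.range (k + 2),
          if lastTx δ (fun i => ε i ω) (k + 1) < i then ‖ε i ω‖ ^ 2 else 0 := by
      intro ω
      rw [← Finset.sum_filter]
      congr 1
      ext i
      simp only [Finset.mem_Ioc, Finset.mem_filter, Finset.mem_range]
      omega
    simp only [decision, h4, Nat.succ_ne_zero, false_or]
    refine Measurable.ite (measurableSet_lt measurable_const ?_) measurable_const measurable_const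
    refine Finset.measurable_fun_sum _ fun i hi => Measurable.ite ?_ ?_ measurable_const
    · exact h3 (measurableSet_Iio (a := i))
    · have := hε i (by rw [Finset.mem_range] at hi; omega)
      fun_prop

end

/-! ### Regrouping independent random variables -/

section Independence

variable {Ω α β γ : Type*} [MeasurableSpace Ω] [MeasurableSpace α] [MeasurableSpace β]
  [MeasurableSpace γ] {μ : Measure Ω}

/-- Under the hypotheses the law of the triple is a threefold product, and such a product may be
bracketed either way. -/
theorem indepFun_prodMk_left_of_right [IsProbabilityMeasure μ] {X : Ω → α} {Y : Ω → β} {Z : Ω → γ}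
    (hX : Measurable X)
    (hY : Measurable Y) (hZ : Measurable Z) (h : IndepFun X (fun ω => (Y ω, Z ω)) μ)
    (hYZ : IndepFun Y Z μ) : IndepFun (fun ω => (X ω, Y ω)) Z μ := by
  have hXY : IndepFun X Y μ := h.comp measurable_id measurable_fst
  have h1 := (indepFun_iff_map_prod_eq_prod_map_map hX.aemeasurable
    (hY.prodMk hZ).aemeasurable).1 h
  rw [(indepFun_iff_map_prod_eq_prod_map_map hY.aemeasurable hZ.aemeasurable).1 hYZ] at h1
  rw [indepFun_iff_map_prod_eq_prod_map_map (hX.prodMk hY).aemeasurable hZ.aemeasurable,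
    (indepFun_iff_map_prod_eq_prod_map_map hX.aemeasurable hY.aemeasurable).1 hXY]
  have := Measure.isProbabilityMeasure_map (μ := μ) hX.aemeasurable
  have := Measure.isProbabilityMeasure_map (μ := μ) hY.aemeasurable
  have := Measure.isProbabilityMeasure_map (μ := μ) hZ.aemeasurable
  rw [← MeasurableEquiv.prodAssoc.map_measurableEquiv_injective.eq_iff, Measure.prodAssoc_prod,
    ← h1, Measure.map_map (MeasurableEquiv.measurable _) (by fun_prop)]
  rfl

theorem IndepFun.of_measurable_comap_right {X : Ω → α} {Y : Ω → β} {Z : Ω → γ}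
    (h : IndepFun X Y μ) (hZ : Measurable[MeasurableSpace.comap Y inferInstance] Z) :
    IndepFun X Z μ :=
  (IndepFun_iff_Indep ..).2 <| indep_of_indep_of_le_right ((IndepFun_iff_Indep ..).1 h) hZ.comap_le

theorem IndepFun.of_eq_comp_left {δ : Type*} [MeasurableSpace δ] {X : Ω → α} {W : Ω → γ}
    {Z : Ω → δ} (h : IndepFun X W μ) (f : α → δ) (hf : Measurable f) (hZ : ∀ ω, Z ω = f (X ω)) :
    IndepFun Z W μ := by
  rw [funext hZ]
  exact h.comp hf measurable_id

theorem iIndepFun_nat_of_indepFun_range [IsProbabilityMeasure μ] {f : ℕ → Ω → α}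
    (h : ∀ k, IndepFun (f k) (fun ω (i : Finset.range k) => f i ω) μ) : iIndepFun f μ := by
  have key : ∀ k, ∀ s : ℕ → Set α, (∀ i, MeasurableSet (s i)) →
      μ (⋂ i ∈ Finset.range k, f i ⁻¹' s i) = ∏ i ∈ Finset.range k, μ (f i ⁻¹' s i) := by
    intro k s hs
    induction k with
    | zero => simp
    | succ k ih =>
      have h1 : (⋂ i ∈ Finset.range (k + 1), f i ⁻¹' s i) = f k ⁻¹' s k ∩
          (fun ω (i : Finset.range k) => f i ω) ⁻¹' (Set.univ.pi fun i => s i) := by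
        ext ω
        simp only [Finset.range_add_one, Finset.mem_insert, Set.iInter_iInter_eq_or_left]
        simp
      have h2 : (fun ω (i : Finset.range k) => f i ω) ⁻¹' (Set.univ.pi fun i => s i) =
          ⋂ i ∈ Finset.range k, f i ⁻¹' s i := by
        ext ω; simp
      rw [h1, (h k).measure_inter_preimage_eq_mul _ _ (hs k)
        (MeasurableSet.univ_pi fun i => hs i), h2, ih, Finset.prod_range_succ, mul_comm]
  rw [iIndepFun_iff_measure_inter_preimage_eq_mul]
  intro S s hs
  obtain ⟨k, hk⟩ : ∃ k, S ⊆ Finset.range k := S.exists_nat_subset_range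
  -- An arbitrary finite index set is padded to an initial segment by imposing no constraint at the
  -- extra indices.
  have h3 := key k (fun i => if i ∈ S then s i else Set.univ) fun i => by
    split_ifs with hi
    · exact hs i hi
    · exact MeasurableSet.univ
  have h4 : (⋂ i ∈ Finset.range k, f i ⁻¹' (if i ∈ S then s i else Set.univ)) =
      ⋂ i ∈ S, f i ⁻¹' s i := by
    ext ω
    simp only [Set.mem_iInter, Set.mem_preimage]
    refine ⟨fun h i hi => by simpa [hi] using h i (hk hi), fun h i _ => ?_⟩
    split_ifs with hi
    · exact h i hi
    · trivial
  rw [h4] at h3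
  rw [h3, ← Finset.prod_subset hk]
  · exact Finset.prod_congr rfl fun i hi => by simp [hi]
  · intro i _ hi
    simp [hi]

end Independence

/-! ### Mixed second moments and centered Gaussian vectors -/

section Moments

variable {Ω : Type*} [MeasurableSpace Ω] {μ : Measure Ω} {n m p : ℕ}

/-- The matrix `E[X Yᵀ]` of mixed second moments. -/
def crossMoment (μ : Measure Ω) (X : Ω → EuclideanSpace ℝ (Fin n))
    (Y : Ω → EuclideanSpace ℝ (Fin m)) : Matrix (Fin n) (Fin m) ℝ :=
  Matrix.of fun a b => ∫ ω, X ω a * Y ω b ∂μ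

variable {X X' : Ω → EuclideanSpace ℝ (Fin n)} {Y Y' : Ω → EuclideanSpace ℝ (Fin m)}

theorem memLp_coord {r : ENNReal} (hX : MemLp X r μ) (a : Fin n) : MemLp (fun ω => X ω a) r μ :=
  (EuclideanSpace.proj (𝕜 := ℝ) a).comp_memLp' hX

theorem memLp_toEuclideanLin {r : ENNReal} (hX : MemLp X r μ) (L : Matrix (Fin m) (Fin n) ℝ) :
    MemLp (fun ω => L.toEuclideanLin (X ω)) r μ :=
  (LinearMap.toContinuousLinearMap L.toEuclideanLin).comp_memLp' hX

theorem integrable_coord_mul_coord (hX : MemLp X 2 μ) (hY : MemLp Y 2 μ) (a : Fin n) (b : Fin m) :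
    Integrable (fun ω => X ω a * Y ω b) μ :=
  (memLp_coord hX a).integrable_mul (memLp_coord hY b)

theorem toEuclideanLin_apply_coord (L : Matrix (Fin m) (Fin n) ℝ) (x : EuclideanSpace ℝ (Fin n))
    (a : Fin m) : L.toEuclideanLin x a = ∑ c, L a c * x c := by
  simp [Matrix.toEuclideanLin, Matrix.mulVec, dotProduct]

theorem crossMoment_transpose : (crossMoment μ X Y)ᵀ = crossMoment μ Y X := by
  ext a b
  simp [crossMoment, mul_comm]

theorem crossMoment_map_left (hX : MemLp X 2 μ) (hY : MemLp Y 2 μ)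
    (L : Matrix (Fin p) (Fin n) ℝ) :
    crossMoment μ (fun ω => L.toEuclideanLin (X ω)) Y = L * crossMoment μ X Y := by
  ext a b
  simp only [crossMoment, Matrix.of_apply, Matrix.mul_apply, toEuclideanLin_apply_coord,
    Finset.sum_mul, mul_assoc]
  rw [integral_finsetSum _ fun c _ => (integrable_coord_mul_coord hX hY c b).const_mul _]
  simp [integral_const_mul]

theorem crossMoment_map_right (hX : MemLp X 2 μ) (hY : MemLp Y 2 μ)
    (L : Matrix (Fin p) (Fin m) ℝ) :
    crossMoment μ X (fun ω => L.toEuclideanLin (Y ω)) = crossMoment μ X Y * Lᵀ := by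
  rw [← crossMoment_transpose, crossMoment_map_left hY hX, Matrix.transpose_mul,
    crossMoment_transpose]

theorem crossMoment_add_left (hX : MemLp X 2 μ) (hX' : MemLp X' 2 μ) (hY : MemLp Y 2 μ) :
    crossMoment μ (fun ω => X ω + X' ω) Y = crossMoment μ X Y + crossMoment μ X' Y := by
  ext a b
  simp only [crossMoment, Matrix.of_apply, Matrix.add_apply, PiLp.add_apply, add_mul]
  exact integral_add (integrable_coord_mul_coord hX hY a b) (integrable_coord_mul_coord hX' hY a b)

theorem crossMoment_sub_left (hX : MemLp X 2 μ) (hX' : MemLp X' 2 μ) (hY : MemLp Y 2 μ) :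
    crossMoment μ (fun ω => X ω - X' ω) Y = crossMoment μ X Y - crossMoment μ X' Y := by
  ext a b
  simp only [crossMoment, Matrix.of_apply, Matrix.sub_apply, PiLp.sub_apply, sub_mul]
  exact integral_sub (integrable_coord_mul_coord hX hY a b) (integrable_coord_mul_coord hX' hY a b)

theorem crossMoment_add_right (hX : MemLp X 2 μ) (hY : MemLp Y 2 μ) (hY' : MemLp Y' 2 μ) :
    crossMoment μ X (fun ω => Y ω + Y' ω) = crossMoment μ X Y + crossMoment μ X Y' := by
  rw [← crossMoment_transpose, crossMoment_add_left hY hY' hX, Matrix.transpose_add,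
    crossMoment_transpose, crossMoment_transpose]

theorem crossMoment_sub_right (hX : MemLp X 2 μ) (hY : MemLp Y 2 μ) (hY' : MemLp Y' 2 μ) :
    crossMoment μ X (fun ω => Y ω - Y' ω) = crossMoment μ X Y - crossMoment μ X Y' := by
  rw [← crossMoment_transpose, crossMoment_sub_left hY hY' hX, Matrix.transpose_sub,
    crossMoment_transpose, crossMoment_transpose]

/-- `X` is Gaussian with mean zero and covariance matrix `M`. -/
structure IsCenteredGaussian (μ : Measure Ω) (X : Ω → EuclideanSpace ℝ (Fin n))
    (M : Matrix (Fin n) (Fin n) ℝ) : Prop where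
  gaussian : HasGaussianLaw X μ
  mean : ∀ a, ∫ ω, X ω a ∂μ = 0
  cov : crossMoment μ X X = M

namespace IsCenteredGaussian

variable {M : Matrix (Fin n) (Fin n) ℝ} {M' : Matrix (Fin m) (Fin m) ℝ}

theorem memLp (h : IsCenteredGaussian μ X M) : MemLp X 2 μ := h.gaussian.memLp_two

theorem mean_toEuclideanLin [IsProbabilityMeasure μ] (h : IsCenteredGaussian μ X M)
    (L : Matrix (Fin m) (Fin n) ℝ)
    (a : Fin m) : ∫ ω, L.toEuclideanLin (X ω) a ∂μ = 0 := by
  simp_rw [toEuclideanLin_apply_coord]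
  rw [integral_finsetSum _ fun c _ =>
    ((memLp_coord h.memLp c).integrable (by norm_num)).const_mul _]
  simp [integral_const_mul, h.mean]

theorem map [IsProbabilityMeasure μ] (h : IsCenteredGaussian μ X M) (L : Matrix (Fin m) (Fin n) ℝ) :
    IsCenteredGaussian μ (fun ω => L.toEuclideanLin (X ω)) (L * M * Lᵀ) where
  gaussian := h.gaussian.map_fun (LinearMap.toContinuousLinearMap L.toEuclideanLin)
  mean := h.mean_toEuclideanLin L
  cov := by
    rw [crossMoment_map_left h.memLp (memLp_toEuclideanLin h.memLp L),
      crossMoment_map_right h.memLp h.memLp, h.cov, Matrix.mul_assoc]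

theorem crossMoment_eq_zero (h : IsCenteredGaussian μ X M) (h' : IsCenteredGaussian μ Y M')
    (hi : IndepFun X Y μ) : crossMoment μ X Y = 0 := by
  ext a b
  have := hi.integral_fun_comp_mul_comp h.gaussian.aemeasurable h'.gaussian.aemeasurable
    (f := fun x => x a) (g := fun y => y b) (Measurable.aestronglyMeasurable (by fun_prop))
    (Measurable.aestronglyMeasurable (by fun_prop))
  simp [crossMoment, this, h.mean]

theorem add [IsProbabilityMeasure μ] {N : Matrix (Fin n) (Fin n) ℝ} (h : IsCenteredGaussian μ X M)
    (h' : IsCenteredGaussian μ X' N) (hi : IndepFun X X' μ) :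
    IsCenteredGaussian μ (fun ω => X ω + X' ω) (M + N) where
  gaussian := (hi.hasGaussianLaw h.gaussian h'.gaussian).fun_add
  mean a := by
    simp only [PiLp.add_apply]
    rw [integral_add ((memLp_coord h.memLp a).integrable (by norm_num))
      ((memLp_coord h'.memLp a).integrable (by norm_num)), h.mean, h'.mean, add_zero]
  cov := by
    rw [crossMoment_add_left h.memLp h'.memLp (Y := fun ω => X ω + X' ω) (h.memLp.add h'.memLp),
      crossMoment_add_right h.memLp h.memLp h'.memLp,
      crossMoment_add_right h'.memLp h.memLp h'.memLp, h.cov, h'.cov,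
      h.crossMoment_eq_zero h' hi, h'.crossMoment_eq_zero h hi.symm, add_zero, zero_add]

theorem integral_inner_mul_inner (hX : MemLp X 2 μ) (hY : MemLp Y 2 μ)
    (x : EuclideanSpace ℝ (Fin n)) (y : EuclideanSpace ℝ (Fin m)) :
    ∫ ω, inner ℝ x (X ω) * inner ℝ y (Y ω) ∂μ = x ⬝ᵥ crossMoment μ X Y *ᵥ y := by
  have h1 : ∀ ω, inner ℝ x (X ω) * inner ℝ y (Y ω) =
      ∑ a, ∑ b, x a * y b * (X ω a * Y ω b) := by
    intro ω
    simp only [PiLp.inner_apply, Finset.sum_mul_sum]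
    refine Finset.sum_congr rfl fun a _ => Finset.sum_congr rfl fun b _ => ?_
    simp only [RCLike.inner_apply, conj_trivial]
    ring
  simp_rw [h1]
  rw [integral_finsetSum _ fun a _ => integrable_finsetSum _ fun b _ =>
    (integrable_coord_mul_coord hX hY a b).const_mul _]
  simp only [dotProduct, Matrix.mulVec, Finset.mul_sum]
  refine Finset.sum_congr rfl fun a _ => ?_
  rw [integral_finsetSum _ fun b _ => (integrable_coord_mul_coord hX hY a b).const_mul _]
  refine Finset.sum_congr rfl fun b _ => ?_
  rw [integral_const_mul, crossMoment, Matrix.of_apply]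
  ring

theorem integral_inner [IsProbabilityMeasure μ] (h : IsCenteredGaussian μ X M)
    (x : EuclideanSpace ℝ (Fin n)) :
    ∫ ω, inner ℝ x (X ω) ∂μ = 0 := by
  have h1 : ∀ ω, inner ℝ x (X ω) = ∑ a, x a * X ω a := by
    intro ω
    simp [PiLp.inner_apply, mul_comm]
  simp_rw [h1]
  rw [integral_finsetSum _ fun c _ =>
    ((memLp_coord h.memLp c).integrable (by norm_num)).const_mul _]
  simp [integral_const_mul, h.mean]

/-- This makes the prior covariances of the filter positive semidefinite without analysing their
recursion: they are covariances of actual random vectors. -/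
theorem posSemidef [IsProbabilityMeasure μ] (h : IsCenteredGaussian μ X M) : M.PosSemidef := by
  refine Matrix.PosSemidef.of_dotProduct_mulVec_nonneg ?_ fun x => ?_
  · rw [Matrix.IsHermitian, Matrix.conjTranspose_eq_transpose_of_trivial, ← h.cov,
      crossMoment_transpose]
  · have := integral_inner_mul_inner h.memLp h.memLp (WithLp.toLp 2 x) (WithLp.toLp 2 x)
    rw [h.cov] at this
    rw [star_trivial]
    refine le_of_le_of_eq ?_ this
    exact integral_nonneg fun ω => mul_self_nonneg _

/-- For jointly Gaussian vectors, vanishing covariance of all pairs of linear functionals gives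
independence. -/
theorem indepFun [IsProbabilityMeasure μ] (h : IsCenteredGaussian μ X M)
    (h' : IsCenteredGaussian μ Y M')
    (hg : HasGaussianLaw (fun ω => (X ω, Y ω)) μ) (hc : crossMoment μ X Y = 0) :
    IndepFun X Y μ := by
  refine hg.indepFun_of_covariance_inner fun x y => ?_
  rw [covariance_eq_sub (h.memLp.const_inner x) (h'.memLp.const_inner y), h.integral_inner,
    zero_mul, sub_zero]
  simp only [Pi.mul_apply]
  rw [integral_inner_mul_inner h.memLp h'.memLp, hc]
  simp

theorem of_hasLaw [IsProbabilityMeasure μ] (hM : M.PosSemidef) {x : EuclideanSpace ℝ (Fin n)}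
    (h : HasLaw X (multivariateGaussian x M) μ) :
    IsCenteredGaussian μ (fun ω => X ω - x) M := by
  have hmean : ∀ a, ∫ y, y a ∂(multivariateGaussian x M) = x a := by
    intro a
    have := (EuclideanSpace.proj (𝕜 := ℝ) a).integral_comp_comm
      (IsGaussian.integrable_id (μ := multivariateGaussian x M))
    simpa using this
  refine ⟨?_, fun a => ?_, ?_⟩
  · have h1 : HasGaussianLaw (fun y => y - x) (multivariateGaussian x M) := by
      simp only [sub_eq_add_neg]
      exact ⟨inferInstance⟩
    refine ⟨?_⟩
    have h2 := h1.isGaussian_map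
    rw [← h.map_eq, AEMeasurable.map_map_of_aemeasurable (by fun_prop) h.aemeasurable] at h2
    exact h2
  · have := h.integral_comp (f := fun y => (y - x) a)
        (Measurable.aestronglyMeasurable (by fun_prop))
    simp only [Function.comp_def] at this
    rw [this]
    simp only [PiLp.sub_apply]
    have hi : Integrable (fun y : EuclideanSpace ℝ (Fin n) => y a) (multivariateGaussian x M) :=
      (memLp_coord IsGaussian.memLp_two_id a).integrable (by norm_num)
    rw [integral_sub hi (integrable_const _)]
    simp [hmean]
  · ext a b
    have := h.integral_comp (f := fun y => (y - x) a * (y - x) b)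
      (Measurable.aestronglyMeasurable (by fun_prop))
    simp only [Function.comp_def] at this
    rw [crossMoment, Matrix.of_apply, this, ← covariance_eval_multivariateGaussian (μ := x) hM a b,
      covariance]
    simp [hmean]

/-- A Gaussian characteristic function is determined by the mean and variance of each linear
functional. -/
theorem map_eq_stdGaussian [IsProbabilityMeasure μ] (h : IsCenteredGaussian μ X 1) :
    μ.map X = stdGaussian (EuclideanSpace ℝ (Fin n)) := by
  have := Measure.isProbabilityMeasure_map (μ := μ) h.gaussian.aemeasurable
  refine Measure.ext_of_charFun (funext fun t => ?_)
  have h1 := integral_inner_mul_inner h.memLp h.memLp t t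
  rw [h.gaussian.charFun_map_eq, charFun_stdGaussian, variance_eq_sub (h.memLp.const_inner t),
    h.integral_inner]
  have h2 : ∫ ω, ((fun ω => inner ℝ t (X ω)) ^ 2) ω ∂μ = ‖t‖ ^ 2 := by
    simp only [Pi.pow_apply, pow_two]
    rw [h1, h.cov, ← pow_two, EuclideanSpace.real_norm_sq_eq]
    simp [dotProduct, pow_two]
  rw [h2]
  simp [neg_div]

theorem ae_eq_zero [IsProbabilityMeasure μ] (h : IsCenteredGaussian μ X 0) : X =ᵐ[μ] 0 := by
  have h1 : ∀ a, ∀ᵐ ω ∂μ, X ω a = 0 := by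
    intro a
    have h2 : ∫ ω, X ω a * X ω a ∂μ = 0 := by
      have := congrFun (congrFun h.cov a) a
      simpa [crossMoment] using this
    rw [integral_eq_zero_iff_of_nonneg (fun ω => mul_self_nonneg _)
      (integrable_coord_mul_coord h.memLp h.memLp a a)] at h2
    filter_upwards [h2] with ω hω
    simpa using hω
  filter_upwards [ae_all_iff.2 h1] with ω hω
  ext a
  simpa using hω a

end IsCenteredGaussian

end Moments

/-! ### Errors of the sensor's Kalman filter -/

namespace LinearSystem

variable {Ω : Type*} {n m : ℕ} (S : LinearSystem n m) (N : Inputs Ω n m)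

/-- The prediction error `x k - x̂^L_{k|k-1}`. -/
def priorErr (k : ℕ) (ω : Ω) : EuclideanSpace ℝ (Fin n) := S.state N k ω - S.priorEst N k ω

/-- The filtering error `x k - x̂^L_k`. -/
def postErr (k : ℕ) (ω : Ω) : EuclideanSpace ℝ (Fin n) := S.state N k ω - S.localEst N k ω

theorem innovation_eq (k : ℕ) (ω : Ω) : S.innovation N k ω =
    (S.gain k).toEuclideanLin (S.C.toEuclideanLin (S.priorErr N k ω) + N.v k ω) := by
  rw [innovation, output, priorErr, map_sub S.C.toEuclideanLin, add_sub_right_comm]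

theorem postErr_eq (k : ℕ) (ω : Ω) :
    S.postErr N k ω = S.priorErr N k ω - S.innovation N k ω := by
  simp only [postErr, priorErr, localEst]
  abel

theorem priorEst_succ (k : ℕ) (ω : Ω) :
    S.priorEst N (k + 1) ω = S.A.toEuclideanLin (S.localEst N k ω) := rfl

theorem priorErr_succ (k : ℕ) (ω : Ω) :
    S.priorErr N (k + 1) ω = S.A.toEuclideanLin (S.postErr N k ω) + N.w k ω := by
  simp only [priorErr, postErr, state, priorEst_succ, map_sub]
  abel

section Measurability

variable {S N} {mΩ : MeasurableSpace Ω}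

theorem measurable_toEuclideanLin {p r : ℕ} (L : Matrix (Fin p) (Fin r) ℝ) :
    Measurable L.toEuclideanLin :=
  (LinearMap.toContinuousLinearMap L.toEuclideanLin).measurable

theorem measurable_pi_of_forall {ι β : Type*} [MeasurableSpace β] {f : Ω → ι → β}
    (h : ∀ i, Measurable fun ω => f ω i) : Measurable f := measurable_pi_lambda _ h

/-- Here and below the σ-algebra is arbitrary and only the inputs that matter are assumed
measurable. Applied to a generated σ-algebra, these statements express which inputs a process
depends on. -/
theorem measurable_state {k : ℕ} (h0 : Measurable N.x0) (hw : ∀ j < k, Measurable (N.w j)) :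
    Measurable (S.state N k) := by
  induction k with
  | zero => exact h0
  | succ k ih =>
    exact ((measurable_toEuclideanLin S.A).comp (ih fun j hj => hw j (by omega))).add
      (hw k (by omega))

theorem measurable_innovation_of_priorEst {k : ℕ} (h0 : Measurable N.x0)
    (hw : ∀ j < k, Measurable (N.w j)) (hv : Measurable (N.v k))
    (hp : Measurable (S.priorEst N k)) : Measurable (S.innovation N k) :=
  (measurable_toEuclideanLin _).comp ((((measurable_toEuclideanLin S.C).comp
    (measurable_state h0 hw)).add hv).sub ((measurable_toEuclideanLin S.C).comp hp))

theorem measurable_priorEst {k : ℕ} (h0 : Measurable N.x0) (hw : ∀ j < k, Measurable (N.w j))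
    (hv : ∀ j < k, Measurable (N.v j)) : Measurable (S.priorEst N k) := by
  induction k with
  | zero => exact measurable_const
  | succ k ih =>
    have h1 := ih (fun j hj => hw j (by omega)) fun j hj => hv j (by omega)
    exact (measurable_toEuclideanLin S.A).comp (h1.add (measurable_innovation_of_priorEst h0
      (fun j hj => hw j (by omega)) (hv k (by omega)) h1))

theorem measurable_innovation {k : ℕ} (h0 : Measurable N.x0) (hw : ∀ j < k, Measurable (N.w j))
    (hv : ∀ j ≤ k, Measurable (N.v j)) : Measurable (S.innovation N k) :=
  measurable_innovation_of_priorEst h0 hw (hv k le_rfl)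
    (measurable_priorEst h0 hw fun j hj => hv j hj.le)

theorem measurable_priorErr {k : ℕ} (h0 : Measurable N.x0) (hw : ∀ j < k, Measurable (N.w j))
    (hv : ∀ j < k, Measurable (N.v j)) : Measurable (S.priorErr N k) :=
  (measurable_state h0 hw).sub (measurable_priorEst h0 hw hv)

theorem measurable_postErr {k : ℕ} (h0 : Measurable N.x0) (hw : ∀ j < k, Measurable (N.w j))
    (hv : ∀ j ≤ k, Measurable (N.v j)) : Measurable (S.postErr N k) := by
  have h : S.postErr N k = fun ω => S.priorErr N k ω - S.innovation N k ω :=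
    funext fun ω => S.postErr_eq N k ω
  rw [h]
  exact (measurable_priorErr h0 hw fun j hj => hv j hj.le).sub (measurable_innovation h0 hw hv)

theorem measurable_localEst_of_innovation {k : ℕ}
    (hz : ∀ j ≤ k, Measurable (S.innovation N j)) : Measurable (S.localEst N k) := by
  induction k with
  | zero => exact measurable_const.add (hz 0 le_rfl)
  | succ k ih =>
    exact ((measurable_toEuclideanLin S.A).comp (ih fun j hj => hz j (by omega))).add
      (hz (k + 1) le_rfl)

end Measurability

variable {S N} [MeasurableSpace Ω] {μ : Measure Ω} [IsProbabilityMeasure μ]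

theorem gainOf_mul {P : Matrix (Fin n) (Fin n) ℝ} (hP : P.PosSemidef) (hR : S.R.PosDef) :
    S.gainOf P * (S.C * P * S.Cᵀ + S.R) = P * S.Cᵀ := by
  have h1 : (S.C * P * S.Cᵀ + S.R).PosDef := by
    have := hP.mul_mul_conjTranspose_same S.C
    rw [Matrix.conjTranspose_eq_transpose_of_trivial] at this
    exact Matrix.PosDef.posSemidef_add this hR
  rw [gainOf, Matrix.mul_assoc, Matrix.nonsing_inv_mul _
    ((Matrix.isUnit_iff_isUnit_det _).1 h1.isUnit),
    Matrix.mul_one]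

theorem transpose_gainOf_mul {P : Matrix (Fin n) (Fin n) ℝ} (hP : Pᵀ = P) (hR : S.Rᵀ = S.R) :
    (S.gainOf P * S.C * P)ᵀ = S.gainOf P * S.C * P := by
  simp only [gainOf, Matrix.transpose_mul, Matrix.transpose_nonsing_inv, Matrix.transpose_add,
    Matrix.transpose_transpose, hP, hR, Matrix.mul_assoc]

/-- The left side is the covariance of the gain applied to the measurement residual; the normal
equation `gainOf_mul` collapses it to the drop from prior to posterior covariance. -/
theorem gainOf_mul_mul_transpose {P : Matrix (Fin n) (Fin n) ℝ} (hP : P.PosSemidef)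
    (hR : S.R.PosDef) :
    S.gainOf P * (S.C * P * S.Cᵀ + S.R) * (S.gainOf P)ᵀ = S.gainOf P * S.C * P := by
  have hPt : Pᵀ = P := by simpa using hP.isHermitian.eq
  have hRt : S.Rᵀ = S.R := by simpa using hR.isHermitian.eq
  rw [gainOf_mul hP hR, ← transpose_gainOf_mul hPt hRt]
  simp [Matrix.transpose_mul, hPt, Matrix.mul_assoc]

theorem innovCov_eq (k : ℕ) : S.innovCov k = S.gain k * S.C * S.priorCov k := by
  simp [innovCov, postCov]

/-- The measurement update: if the prediction error `X` and the measurement noise `V` are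
independent, then the innovation and the updated error are independent centered Gaussians. -/
theorem measurement_update (hR : S.R.PosDef) {k : ℕ} {X : Ω → EuclideanSpace ℝ (Fin n)}
    {V : Ω → EuclideanSpace ℝ (Fin m)} (hX : IsCenteredGaussian μ X (S.priorCov k))
    (hV : IsCenteredGaussian μ V S.R) (hXV : IndepFun X V μ) :
    let Z := fun ω => (S.gain k).toEuclideanLin (S.C.toEuclideanLin (X ω) + V ω)
    IsCenteredGaussian μ Z (S.innovCov k) ∧
      IsCenteredGaussian μ (fun ω => X ω - Z ω) (S.postCov k) ∧
      IndepFun Z (fun ω => X ω - Z ω) μ := by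
  intro Z
  have hP := hX.posSemidef
  have hPt : (S.priorCov k)ᵀ = S.priorCov k := by simpa using hP.isHermitian.eq
  have hRt : S.Rᵀ = S.R := by simpa using hR.isHermitian.eq
  have hr := (hX.map S.C).add hV (hXV.comp (measurable_toEuclideanLin S.C) measurable_id)
  have hZ : IsCenteredGaussian μ Z (S.innovCov k) := by
    have := hr.map (S.gain k)
    rwa [gain, gainOf_mul_mul_transpose hP hR, ← gain, ← innovCov_eq] at this
  have hZX : crossMoment μ Z X = S.innovCov k := by
    rw [crossMoment_map_left (L := S.gain k) hr.memLp hX.memLp,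
      crossMoment_add_left (X' := V) (hX.map S.C).memLp hV.memLp hX.memLp,
      crossMoment_map_left hX.memLp hX.memLp, hX.cov, hV.crossMoment_eq_zero hX hXV.symm, add_zero,
      innovCov_eq, Matrix.mul_assoc]
  have hXZ : crossMoment μ X Z = S.innovCov k := by
    rw [← crossMoment_transpose, hZX, innovCov_eq, gain, transpose_gainOf_mul hPt hRt]
  have hE2 : MemLp (fun ω => X ω - Z ω) 2 μ := hX.memLp.sub hZ.memLp
  -- Orthogonality principle: the optimal gain makes `E[Z Xᵀ]` equal to `E[Z Zᵀ]`.
  have hZE : crossMoment μ Z (fun ω => X ω - Z ω) = 0 := by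
    rw [crossMoment_sub_right hZ.memLp hX.memLp hZ.memLp, hZX, hZ.cov, sub_self]
  -- The pair is a linear image of the jointly Gaussian pair `(X, V)`, so the orthogonality upgrades
  -- to independence.
  have hjoint : HasGaussianLaw (fun ω => (Z ω, X ω - Z ω)) μ := by
    have h1 := hXV.hasGaussianLaw hX.gaussian hV.gaussian
    let K := LinearMap.toContinuousLinearMap (S.gain k).toEuclideanLin
    let C := LinearMap.toContinuousLinearMap S.C.toEuclideanLin
    let L : EuclideanSpace ℝ (Fin n) × EuclideanSpace ℝ (Fin m) →L[ℝ] EuclideanSpace ℝ (Fin n) :=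
      K ∘L (C ∘L ContinuousLinearMap.fst ℝ _ _ + ContinuousLinearMap.snd ℝ _ _)
    exact h1.map_fun (L.prod (ContinuousLinearMap.fst ℝ _ _ - L))
  have hE : IsCenteredGaussian μ (fun ω => X ω - Z ω) (S.postCov k) := by
    refine ⟨hjoint.snd, fun a => ?_, ?_⟩
    · simp only [PiLp.sub_apply]
      rw [integral_sub ((memLp_coord hX.memLp a).integrable (by norm_num))
        ((memLp_coord hZ.memLp a).integrable (by norm_num)), hX.mean, hZ.mean, sub_self]
    · rw [crossMoment_sub_left hX.memLp hZ.memLp hE2, hZE,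
        crossMoment_sub_right hX.memLp hX.memLp hZ.memLp, hX.cov, hXZ, innovCov]
      simp
  exact ⟨hZ, hE, hZ.indepFun hE hjoint hZE⟩

end LinearSystem

/-! ### Independence of innovations and filtering errors -/

namespace Inputs.IsGaussianWhite

variable {Ω : Type*} {n m : ℕ} {S : LinearSystem n m} {N : Inputs Ω n m} [MeasurableSpace Ω]
  {μ : Measure Ω}

theorem indepFun_v [IsProbabilityMeasure μ] (hN : N.IsGaussianWhite μ S) (k : ℕ) :
    IndepFun (N.v k)
      (fun ω => ((fun j : Finset.range k => N.v j ω), N.x0 ω, fun j => N.w j ω)) μ := by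
  have hx := hN.measurable_x0
  have hw := hN.measurable_w
  have hv := hN.measurable_v
  have h1 : IndepFun (fun ω => (N.x0 ω, fun j => N.w j ω)) (fun ω j => N.v j ω) μ :=
    indepFun_prodMk_left_of_right hx (by fun_prop) (by fun_prop) hN.indep_x0 hN.indep_noise
  have h2 : IndepFun (fun ω (j : Finset.range k) => N.v j ω) (N.v k) μ :=
    (hN.white_v.indepFun_finset (Finset.range k) {k} (by simp) hv).comp measurable_id
      (measurable_pi_apply (⟨k, Finset.mem_singleton_self k⟩ : ({k} : Finset ℕ)))
  have h3 : IndepFun (fun ω => ((N.x0 ω, fun j => N.w j ω), fun j : Finset.range k => N.v j ω))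
      (N.v k) μ :=
    indepFun_prodMk_left_of_right (by fun_prop) (by fun_prop) (hv k)
      (h1.comp measurable_id
        (ψ := fun v : ℕ → EuclideanSpace ℝ (Fin m) => ((fun j : Finset.range k => v j), v k))
        (by fun_prop)) h2
  exact (h3.comp (φ := fun p => (p.2, p.1.1, p.1.2)) (by fun_prop) measurable_id).symm

theorem indepFun_w [IsProbabilityMeasure μ] (hN : N.IsGaussianWhite μ S) (k : ℕ) :
    IndepFun (N.w k)
      (fun ω => ((fun j : Finset.range k => N.w j ω), N.x0 ω, fun j => N.v j ω)) μ := by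
  have hx := hN.measurable_x0
  have hw := hN.measurable_w
  have hv := hN.measurable_v
  have h1 : IndepFun (fun ω => (N.x0 ω, fun j => N.v j ω)) (fun ω j => N.w j ω) μ :=
    indepFun_prodMk_left_of_right hx (by fun_prop) (by fun_prop)
      (hN.indep_x0.comp measurable_id measurable_swap) hN.indep_noise.symm
  have h2 : IndepFun (fun ω (j : Finset.range k) => N.w j ω) (N.w k) μ :=
    (hN.white_w.indepFun_finset (Finset.range k) {k} (by simp) hw).comp measurable_id
      (measurable_pi_apply (⟨k, Finset.mem_singleton_self k⟩ : ({k} : Finset ℕ)))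
  have h3 : IndepFun (fun ω => ((N.x0 ω, fun j => N.v j ω), fun j : Finset.range k => N.w j ω))
      (N.w k) μ :=
    indepFun_prodMk_left_of_right (by fun_prop) (by fun_prop) (hw k)
      (h1.comp measurable_id
        (ψ := fun v : ℕ → EuclideanSpace ℝ (Fin n) => ((fun j : Finset.range k => v j), v k))
        (by fun_prop)) h2
  exact (h3.comp (φ := fun p => (p.2, p.1.1, p.1.2)) (by fun_prop) measurable_id).symm

theorem measurable_innovation (hN : N.IsGaussianWhite μ S) (k : ℕ) :
    Measurable (S.innovation N k) :=
  LinearSystem.measurable_innovation hN.measurable_x0 (fun j _ => hN.measurable_w j)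
    fun j _ => hN.measurable_v j

theorem measurable_priorErr (hN : N.IsGaussianWhite μ S) (k : ℕ) :
    Measurable (S.priorErr N k) :=
  LinearSystem.measurable_priorErr hN.measurable_x0 (fun j _ => hN.measurable_w j)
    fun j _ => hN.measurable_v j

theorem measurable_postErr (hN : N.IsGaussianWhite μ S) (k : ℕ) :
    Measurable (S.postErr N k) :=
  LinearSystem.measurable_postErr hN.measurable_x0 (fun j _ => hN.measurable_w j)
    fun j _ => hN.measurable_v j

/-- Causality: the right-hand variables use only the initial state, the process noise and the
measurement noise before `k`. -/
theorem indepFun_v_prior [IsProbabilityMeasure μ] (hN : N.IsGaussianWhite μ S) (k : ℕ) :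
    IndepFun (N.v k)
      (fun ω => (S.priorErr N k ω, fun j : Finset.range k => S.innovation N j ω)) μ := by
  refine IndepFun.of_measurable_comap_right (hN.indepFun_v k) ?_
  set f := fun ω => ((fun j : Finset.range k => N.v j ω), N.x0 ω, fun j => N.w j ω)
  have hf : Measurable[MeasurableSpace.comap f inferInstance] f := comap_measurable f
  have hv : ∀ j < k, Measurable[MeasurableSpace.comap f inferInstance] (N.v j) := fun j hj =>
    (measurable_pi_apply (⟨j, by simpa using hj⟩ : Finset.range k)).comp (measurable_fst.comp hf)
  have hx : Measurable[MeasurableSpace.comap f inferInstance] N.x0 :=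
    measurable_fst.comp (measurable_snd.comp hf)
  have hw : ∀ j, Measurable[MeasurableSpace.comap f inferInstance] (N.w j) := fun j =>
    (measurable_pi_apply j).comp (measurable_snd.comp (measurable_snd.comp hf))
  refine Measurable.prodMk (LinearSystem.measurable_priorErr hx (fun j _ => hw j) hv)
    (LinearSystem.measurable_pi_of_forall fun j => LinearSystem.measurable_innovation hx
      (fun j _ => hw j)
      fun i hi => hv i ?_)
  have := Finset.mem_range.1 j.2
  omega

theorem indepFun_w_post [IsProbabilityMeasure μ] (hN : N.IsGaussianWhite μ S) (k : ℕ) :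
    IndepFun (N.w k)
      (fun ω => (S.postErr N k ω, fun j : Finset.range (k + 1) => S.innovation N j ω)) μ := by
  refine IndepFun.of_measurable_comap_right (hN.indepFun_w k) ?_
  set f := fun ω => ((fun j : Finset.range k => N.w j ω), N.x0 ω, fun j => N.v j ω)
  have hf : Measurable[MeasurableSpace.comap f inferInstance] f := comap_measurable f
  have hw : ∀ j < k, Measurable[MeasurableSpace.comap f inferInstance] (N.w j) := fun j hj =>
    (measurable_pi_apply (⟨j, by simpa using hj⟩ : Finset.range k)).comp (measurable_fst.comp hf)
  have hx : Measurable[MeasurableSpace.comap f inferInstance] N.x0 :=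
    measurable_fst.comp (measurable_snd.comp hf)
  have hv : ∀ j, Measurable[MeasurableSpace.comap f inferInstance] (N.v j) := fun j =>
    (measurable_pi_apply j).comp (measurable_snd.comp (measurable_snd.comp hf))
  refine Measurable.prodMk (LinearSystem.measurable_postErr hx hw fun j _ => hv j)
    (LinearSystem.measurable_pi_of_forall fun j => LinearSystem.measurable_innovation hx
      (fun i hi => hw i ?_)
      fun i _ => hv i)
  have := Finset.mem_range.1 j.2
  omega

theorem innovation_postErr_of_prior [IsProbabilityMeasure μ] (hN : N.IsGaussianWhite μ S)
    (hR : S.R.PosDef) {k : ℕ}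
    (hc : IsCenteredGaussian μ (S.priorErr N k) (S.priorCov k))
    (hi : IndepFun (S.priorErr N k) (fun ω (j : Finset.range k) => S.innovation N j ω) μ) :
    IsCenteredGaussian μ (S.innovation N k) (S.innovCov k) ∧
      IsCenteredGaussian μ (S.postErr N k) (S.postCov k) ∧
      IndepFun (S.innovation N k) (fun ω (j : Finset.range k) => S.innovation N j ω) μ ∧
      IndepFun (S.postErr N k) (fun ω (j : Finset.range (k + 1)) => S.innovation N j ω) μ := by
  have hz := hN.measurable_innovation
  have hV : IsCenteredGaussian μ (N.v k) S.R := by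
    simpa using IsCenteredGaussian.of_hasLaw hR.posSemidef (hN.law_v k)
  have h1 := hN.indepFun_v_prior k
  have h2 := LinearSystem.measurement_update hR hc hV
    (h1.symm.comp (φ := Prod.fst) measurable_fst measurable_id)
  simp only [← LinearSystem.innovation_eq, ← LinearSystem.postErr_eq] at h2
  obtain ⟨hZ, hE, hZE⟩ := h2
  have h3 : IndepFun (fun ω => (N.v k ω, S.priorErr N k ω))
      (fun ω (j : Finset.range k) => S.innovation N j ω) μ :=
    indepFun_prodMk_left_of_right (hN.measurable_v k) (hN.measurable_priorErr k) (by fun_prop) h1 hi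
  have hg : Measurable fun p : EuclideanSpace ℝ (Fin m) × EuclideanSpace ℝ (Fin n) =>
      (S.gain k).toEuclideanLin (S.C.toEuclideanLin p.2 + p.1) :=
    (LinearSystem.measurable_toEuclideanLin _).comp
      (((LinearSystem.measurable_toEuclideanLin _).comp measurable_snd).add measurable_fst)
  have h4 : IndepFun (fun ω => (S.innovation N k ω, S.postErr N k ω))
      (fun ω (j : Finset.range k) => S.innovation N j ω) μ := by
    refine IndepFun.of_eq_comp_left h3 (fun p =>
      ((S.gain k).toEuclideanLin (S.C.toEuclideanLin p.2 + p.1),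
        p.2 - (S.gain k).toEuclideanLin (S.C.toEuclideanLin p.2 + p.1)))
      (hg.prodMk (measurable_snd.sub hg)) fun ω => ?_
    rw [LinearSystem.postErr_eq, LinearSystem.innovation_eq]
  refine ⟨hZ, hE, IndepFun.of_eq_comp_left h4 Prod.fst measurable_fst fun _ => rfl, ?_⟩
  -- The updated error is independent of the newest innovation, and jointly with it of the older
  -- ones; regrouping makes it independent of all of them together.
  have h5 : IndepFun (fun ω => ((fun j : Finset.range k => S.innovation N j ω), S.innovation N k ω))
      (S.postErr N k) μ :=
    indepFun_prodMk_left_of_right (by fun_prop) (hz k) (hN.measurable_postErr k) h4.symm hZE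
  refine IndepFun.of_measurable_comap_right h5.symm ?_
  set f := fun ω => ((fun j : Finset.range k => S.innovation N j ω), S.innovation N k ω)
  have hf : Measurable[MeasurableSpace.comap f inferInstance] f := comap_measurable f
  refine LinearSystem.measurable_pi_of_forall fun ⟨j, hj⟩ => ?_
  rcases (Nat.lt_succ_iff_lt_or_eq.1 (Finset.mem_range.1 hj)) with h | rfl
  · exact (measurable_pi_apply (⟨j, by simpa using h⟩ : Finset.range k)).comp
      (measurable_fst.comp hf)
  · exact measurable_snd.comp hf

/-- The invariant of the filter. The measurement update carries it to the posterior error, and the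
time update adds process noise that is independent of that error and of all innovations so far. -/
theorem priorErr [IsProbabilityMeasure μ] (hN : N.IsGaussianWhite μ S) (hP0 : S.initCov.PosDef)
    (hR : S.R.PosDef)
    (hQ : S.Q.PosSemidef) (k : ℕ) :
    IsCenteredGaussian μ (S.priorErr N k) (S.priorCov k) ∧
      IndepFun (S.priorErr N k) (fun ω (j : Finset.range k) => S.innovation N j ω) μ := by
  induction k with
  | zero =>
    refine ⟨IsCenteredGaussian.of_hasLaw hP0.posSemidef hN.law_x0, ?_⟩
    have : (fun ω (j : Finset.range 0) => S.innovation N j ω) = fun _ => fun _ => 0 := by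
      ext ω j
      simpa using j.2
    rw [this]
    exact indepFun_const_right _ _
  | succ k ih =>
    obtain ⟨-, hE, -, h1⟩ := hN.innovation_postErr_of_prior hR ih.1 ih.2
    have hz := hN.measurable_innovation
    have hW : IsCenteredGaussian μ (N.w k) S.Q := by
      simpa using IsCenteredGaussian.of_hasLaw hQ (hN.law_w k)
    have h2 := hN.indepFun_w_post k
    have heq : S.priorErr N (k + 1) = fun ω => S.A.toEuclideanLin (S.postErr N k ω) + N.w k ω :=
      funext fun ω => S.priorErr_succ N k ω
    have h3 : IndepFun (fun ω => (N.w k ω, S.postErr N k ω))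
        (fun ω (j : Finset.range (k + 1)) => S.innovation N j ω) μ :=
      indepFun_prodMk_left_of_right (hN.measurable_w k) (hN.measurable_postErr k)
        (by fun_prop) h2 h1
    have h4 : IndepFun (fun ω => S.A.toEuclideanLin (S.postErr N k ω)) (N.w k) μ :=
      IndepFun.of_eq_comp_left h2.symm (fun p => S.A.toEuclideanLin p.1)
        ((LinearSystem.measurable_toEuclideanLin S.A).comp measurable_fst) fun _ => rfl
    constructor
    · rw [heq]
      exact (hE.map S.A).add hW h4
    · exact IndepFun.of_eq_comp_left h3 (fun p => S.A.toEuclideanLin p.2 + p.1)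
        (((LinearSystem.measurable_toEuclideanLin S.A).comp measurable_snd).add measurable_fst)
        fun ω => S.priorErr_succ N k ω

theorem isCenteredGaussian_innovation [IsProbabilityMeasure μ] (hN : N.IsGaussianWhite μ S)
    (hP0 : S.initCov.PosDef)
    (hR : S.R.PosDef) (hQ : S.Q.PosSemidef) (k : ℕ) :
    IsCenteredGaussian μ (S.innovation N k) (S.innovCov k) :=
  let h := hN.priorErr hP0 hR hQ k
  (hN.innovation_postErr_of_prior hR h.1 h.2).1

theorem isCenteredGaussian_postErr [IsProbabilityMeasure μ] (hN : N.IsGaussianWhite μ S)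
    (hP0 : S.initCov.PosDef)
    (hR : S.R.PosDef) (hQ : S.Q.PosSemidef) (k : ℕ) :
    IsCenteredGaussian μ (S.postErr N k) (S.postCov k) :=
  let h := hN.priorErr hP0 hR hQ k
  (hN.innovation_postErr_of_prior hR h.1 h.2).2.1

theorem indepFun_postErr [IsProbabilityMeasure μ] (hN : N.IsGaussianWhite μ S)
    (hP0 : S.initCov.PosDef)
    (hR : S.R.PosDef) (hQ : S.Q.PosSemidef) (k : ℕ) :
    IndepFun (S.postErr N k) (fun ω (j : Finset.range (k + 1)) => S.innovation N j ω) μ :=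
  let h := hN.priorErr hP0 hR hQ k
  (hN.innovation_postErr_of_prior hR h.1 h.2).2.2.2

theorem iIndepFun_innovation [IsProbabilityMeasure μ] (hN : N.IsGaussianWhite μ S)
    (hP0 : S.initCov.PosDef)
    (hR : S.R.PosDef) (hQ : S.Q.PosSemidef) : iIndepFun (S.innovation N) μ :=
  iIndepFun_nat_of_indepFun_range fun k =>
    let h := hN.priorErr hP0 hR hQ k
    (hN.innovation_postErr_of_prior hR h.1 h.2).2.2.1

theorem memLp_state (hN : N.IsGaussianWhite μ S) (k : ℕ) : MemLp (S.state N k) 2 μ := by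
  induction k with
  | zero => exact hN.law_x0.hasGaussianLaw.memLp_two
  | succ k ih => exact (memLp_toEuclideanLin ih S.A).add (hN.law_w k).hasGaussianLaw.memLp_two

end Inputs.IsGaussianWhite

/-! ### Whitening the innovations -/

theorem IsSpectralDecomposition.exists_factor {n q : ℕ} (hqn : q ≤ n)
    {M U : Matrix (Fin n) (Fin n) ℝ} {Λ : Fin q → ℝ} (h : IsSpectralDecomposition M U Λ) :
    ∃ B : Matrix (Fin n) (Fin q) ℝ, B * Bᵀ = M ∧ normalizer U Λ * B = 1 := by
  have hU1 : Uᵀ * U = 1 := by simpa using (Matrix.mem_orthogonalGroup_iff' (Fin n) ℝ).1 h.orthogonal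
  have hU2 : U * Uᵀ = 1 := by simpa using (Matrix.mem_orthogonalGroup_iff (Fin n) ℝ).1 h.orthogonal
  let G : Matrix (Fin n) (Fin q) ℝ :=
    Matrix.of fun i a => if (i : ℕ) = a then √(Λ a) else 0
  have hGG : G * Gᵀ = Uᵀ * M * U := by
    rw [h.diag]
    ext i j
    simp only [G, Matrix.mul_apply, Matrix.of_apply, Matrix.transpose_apply, Matrix.diagonal_apply]
    split_ifs with hij hi
    · subst hij
      rw [Finset.sum_eq_single (⟨i, hi⟩ : Fin q)]
      · simp [Real.mul_self_sqrt (h.pos _).le]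
      · intro b _ hb
        rw [if_neg, zero_mul]
        exact fun hib => hb (Fin.ext hib.symm)
      · simp
    · refine Finset.sum_eq_zero fun a _ => ?_
      rw [if_neg, zero_mul]
      have := a.2
      omega
    · refine Finset.sum_eq_zero fun a _ => ?_
      by_cases h1 : (i : ℕ) = a
      · rw [if_neg (fun h2 : (j : ℕ) = a => hij (Fin.ext (h1.trans h2.symm))), mul_zero]
      · rw [if_neg h1, zero_mul]
  refine ⟨U * G, ?_, ?_⟩
  · calc U * G * (U * G)ᵀ = U * (G * Gᵀ) * Uᵀ := by
          rw [Matrix.transpose_mul]; simp only [Matrix.mul_assoc]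
      _ = (U * Uᵀ) * M * (U * Uᵀ) := by rw [hGG]; simp only [Matrix.mul_assoc]
      _ = M := by rw [hU2, Matrix.one_mul, Matrix.mul_one]
  · rw [normalizer, Matrix.mul_assoc, ← Matrix.mul_assoc Uᵀ, hU1, Matrix.one_mul]
    ext a b
    simp only [G, Matrix.mul_apply, Matrix.of_apply, Matrix.one_apply]
    -- This is where `q ≤ n` matters: every eigenvalue index must be a valid coordinate of the state
    -- space.
    rw [Finset.sum_eq_single (⟨a, a.2.trans_le hqn⟩ : Fin n)]
    · simp only [if_true]
      split_ifs with h1 h2 h2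
      · obtain rfl := h2
        exact inv_mul_cancel₀ (Real.sqrt_pos.2 (h.pos _)).ne'
      · exact absurd (Fin.ext h1) h2
      · exact absurd (congrArg _ h2) h1
      · rw [mul_zero]
    · intro i _ hi
      rw [if_neg, zero_mul]
      exact fun hia => hi (Fin.ext hia)
    · simp

theorem toEuclideanLin_mul_apply {p r s : ℕ} (L : Matrix (Fin p) (Fin r) ℝ)
    (K : Matrix (Fin r) (Fin s) ℝ) (x : EuclideanSpace ℝ (Fin s)) :
    (L * K).toEuclideanLin x = L.toEuclideanLin (K.toEuclideanLin x) := by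
  simp [Matrix.toEuclideanLin]

variable {Ω : Type*} [MeasurableSpace Ω] {μ : Measure Ω} [IsProbabilityMeasure μ] {n q : ℕ}

/-- A centered Gaussian vector with factored covariance `B Bᵀ`, where `F B = 1`, is `B` times the
standard Gaussian vector obtained by applying `F`. -/
theorem IsCenteredGaussian.whiten {Z : Ω → EuclideanSpace ℝ (Fin n)}
    {M : Matrix (Fin n) (Fin n) ℝ} (hZ : IsCenteredGaussian μ Z M)
    {B : Matrix (Fin n) (Fin q) ℝ} {F : Matrix (Fin q) (Fin n) ℝ} (hB : B * Bᵀ = M)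
    (hFB : F * B = 1) :
    μ.map (fun ω => F.toEuclideanLin (Z ω)) = stdGaussian (EuclideanSpace ℝ (Fin q)) ∧
      ∀ᵐ ω ∂μ, Z ω = B.toEuclideanLin (F.toEuclideanLin (Z ω)) := by
  constructor
  · have h1 : F * M * Fᵀ = 1 := by
      rw [← hB, ← Matrix.mul_assoc, hFB, Matrix.one_mul, ← Matrix.transpose_mul, hFB,
        Matrix.transpose_one]
    have := hZ.map F
    rw [h1] at this
    exact this.map_eq_stdGaussian
  -- The residual left by `B * F` has zero covariance, so it vanishes almost surely even though the
  -- covariance may be singular.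
  · have h1 : (1 - B * F) * M = 0 := by
      rw [← hB, ← Matrix.mul_assoc, Matrix.sub_mul, Matrix.one_mul, Matrix.mul_assoc B F, hFB,
        Matrix.mul_one, sub_self, Matrix.zero_mul]
    have := hZ.map (1 - B * F)
    rw [h1, Matrix.zero_mul] at this
    filter_upwards [this.ae_eq_zero] with ω hω
    rw [map_sub, LinearMap.sub_apply, toEuclideanLin_mul_apply, Pi.zero_apply, sub_eq_zero] at hω
    rw [← hω]
    simp

/-- Second moments of independent standard Gaussian vectors on the event that the accumulated
squared norms respect the thresholds. -/
theorem setIntegral_silent_of_iIndepFun {ε : ℕ → Ω → EuclideanSpace ℝ (Fin q)}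
    (hm : ∀ i, Measurable (ε i)) (hi : iIndepFun ε μ)
    (hlaw : ∀ i, μ.map (ε i) = stdGaussian (EuclideanSpace ℝ (Fin q))) (δ : ℕ → ℝ) (t r : ℕ)
    {H : Set Ω} (hH : H = {ω | (fun j : Fin r => ε (t + 1 + j) ω) ∈
      (silentEvent δ r (t + 1) : Set (Fin r → EuclideanSpace ℝ (Fin q)))}) :
    (∀ (i : Fin r) (c : Fin q), ∫ ω in H, ε (t + 1 + i) ω c ∂μ = 0) ∧
      ∀ (i j : Fin r) (c d : Fin q), ∫ ω in H, ε (t + 1 + i) ω c * ε (t + 1 + j) ω d ∂μ =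
        (if i = j ∧ c = d then eta q δ t (t + r) (t + 1 + i) else 0) * μ.real H := by
  have hi' : iIndepFun (fun (j : Fin r) ω => ε (t + 1 + j) ω) μ :=
    hi.precomp (g := fun j : Fin r => t + 1 + (j : ℕ)) fun a b hab => Fin.ext (by simpa using hab)
  have hmap : μ.map (fun ω (j : Fin r) => ε (t + 1 + j) ω) = piGaussian q r := by
    rw [(iIndepFun_iff_map_fun_eq_pi_map fun j => (hm _).aemeasurable).1 hi']
    simp_rw [hlaw]
  have hM : Measurable fun ω (j : Fin r) => ε (t + 1 + j) ω := by fun_prop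
  have hS := measurableSet_silentEvent (q := q) (δ := δ) (r := r) (l := t + 1)
  subst hH
  refine ⟨fun i c => ?_, fun i j c d => ?_⟩
  · rw [← setIntegral_silentEvent_coord (δ := δ) (l := t + 1) i c, ← hmap,
      setIntegral_map hS (Measurable.aestronglyMeasurable (by fun_prop)) hM.aemeasurable]
    rfl
  · have h1 := setIntegral_silentEvent_coord_mul (δ := δ) (t := t) i j c d
    rw [← hmap, setIntegral_map hS (Measurable.aestronglyMeasurable (by fun_prop)) hM.aemeasurable,
      map_measureReal_apply hM hS] at h1
    exact h1

/-- Transfer of `setIntegral_silent_of_iIndepFun` to vectors `Z i = B i (ε i)`. -/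
theorem setIntegral_silent_linear_image {ε : ℕ → Ω → EuclideanSpace ℝ (Fin q)}
    {Z : ℕ → Ω → EuclideanSpace ℝ (Fin n)} {B : ℕ → Matrix (Fin n) (Fin q) ℝ}
    (hm : ∀ i, Measurable (ε i)) (hi : iIndepFun ε μ)
    (hlaw : ∀ i, μ.map (ε i) = stdGaussian (EuclideanSpace ℝ (Fin q)))
    (hZ : ∀ i, ∀ᵐ ω ∂μ, Z i ω = (B i).toEuclideanLin (ε i ω)) (δ : ℕ → ℝ) (t r : ℕ)
    {H : Set Ω} (hH : H = {ω | (fun j : Fin r => ε (t + 1 + j) ω) ∈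
      (silentEvent δ r (t + 1) : Set (Fin r → EuclideanSpace ℝ (Fin q)))}) :
    (∀ (i : Fin r) (a : Fin n), ∫ ω in H, Z (t + 1 + i) ω a ∂μ = 0) ∧
      ∀ (i j : Fin r) (a b : Fin n), ∫ ω in H, Z (t + 1 + i) ω a * Z (t + 1 + j) ω b ∂μ =
        (if i = j then eta q δ t (t + r) (t + 1 + i) *
          (B (t + 1 + i) * (B (t + 1 + i))ᵀ) a b else 0) * μ.real H := by
  obtain ⟨h1, h2⟩ := setIntegral_silent_of_iIndepFun hm hi hlaw δ t r hH
  have h2p : ∀ i, MemLp (ε i) 2 μ := fun i => by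
    have : MemLp id 2 (μ.map (ε i)) := by
      rw [hlaw i]
      exact IsGaussian.memLp_two_id
    exact this.comp_of_map (hm i).aemeasurable
  have hZ' := fun i => ae_restrict_of_ae (s := H) (hZ i)
  refine ⟨fun i a => ?_, fun i j a b => ?_⟩
  · have h3 : ∫ ω in H, Z (t + 1 + i) ω a ∂μ =
        ∫ ω in H, ∑ c, B (t + 1 + i) a c * ε (t + 1 + i) ω c ∂μ := by
      refine integral_congr_ae ?_
      filter_upwards [hZ' (t + 1 + i)] with ω hω
      rw [hω, toEuclideanLin_apply_coord]
    rw [h3, integral_finsetSum _ fun c _ =>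
      (((memLp_coord (h2p _) c).integrable (by norm_num)).const_mul _).integrableOn]
    simp [integral_const_mul, h1]
  · have h3 : ∫ ω in H, Z (t + 1 + i) ω a * Z (t + 1 + j) ω b ∂μ =
        ∫ ω in H, ∑ c, ∑ d, B (t + 1 + i) a c * B (t + 1 + j) b d *
          (ε (t + 1 + i) ω c * ε (t + 1 + j) ω d) ∂μ := by
      refine integral_congr_ae ?_
      filter_upwards [hZ' (t + 1 + i), hZ' (t + 1 + j)] with ω hω hω'
      rw [hω, hω', toEuclideanLin_apply_coord, toEuclideanLin_apply_coord, Finset.sum_mul_sum]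
      refine Finset.sum_congr rfl fun c _ => Finset.sum_congr rfl fun d _ => ?_
      ring
    have h4 : ∀ c d, Integrable (fun ω => B (t + 1 + i) a c * B (t + 1 + j) b d *
          (ε (t + 1 + i) ω c * ε (t + 1 + j) ω d)) (μ.restrict H) := fun c d =>
      ((integrable_coord_mul_coord (h2p _) (h2p _) c d).const_mul _).integrableOn
    rw [h3, integral_finsetSum _ fun c _ => integrable_finsetSum _ fun d _ => h4 c d]
    simp_rw [integral_finsetSum _ fun d _ => h4 _ d, integral_const_mul, h2]
    by_cases hij : i = j
    · subst hij
      simp only [true_and, if_true, Matrix.mul_apply, Matrix.transpose_apply, ite_mul, zero_mul,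
        mul_ite, mul_zero, Finset.sum_ite_eq, Finset.mem_univ, Finset.mul_sum, Finset.sum_mul]
      refine Finset.sum_congr rfl fun c _ => ?_
      ring
    · simp [hij]

/-! ### Conditional expectation on the level sets of an observable index -/

section ConditionalExpectation

variable {Ω E : Type*} {mI m₁ m₂ m0 : MeasurableSpace Ω} {μ : Measure Ω}
  [NormedAddCommGroup E]

theorem eq_sum_indicator_fiber {L : Ω → ℕ} {k : ℕ} (hL : ∀ ω, L ω ≤ k) (Φ : ℕ → Ω → E) (ω : Ω) :
    Φ (L ω) ω = ∑ t ∈ Finset.range (k + 1), (L ⁻¹' {t}).indicator (Φ t) ω := by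
  rw [Finset.sum_eq_single (L ω)]
  · simp
  · intro t _ ht
    rw [Set.indicator_of_notMem]
    exact fun h => ht (Set.mem_singleton_iff.1 h).symm
  · intro h
    exact absurd (Finset.mem_range.2 (Nat.lt_succ_of_le (hL ω))) h

theorem integrable_fiber {L : Ω → ℕ} {k : ℕ} (hL : ∀ ω, L ω ≤ k)
    (hLm : ∀ t, MeasurableSet (L ⁻¹' {t})) {Φ : ℕ → Ω → E}
    (hΦ : ∀ t ≤ k, Integrable (Φ t) μ) : Integrable (fun ω => Φ (L ω) ω) μ := by
  simp_rw [eq_sum_indicator_fiber hL Φ]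
  exact integrable_finsetSum _ fun t ht =>
    (hΦ t (Nat.lt_succ_iff.1 (Finset.mem_range.1 ht))).indicator (hLm t)

variable [NormedSpace ℝ E]

theorem setIntegral_fiber {L : Ω → ℕ} {k : ℕ} (hL : ∀ ω, L ω ≤ k)
    (hLm : ∀ t, MeasurableSet (L ⁻¹' {t})) {Φ : ℕ → Ω → E}
    (hΦ : ∀ t ≤ k, Integrable (Φ t) μ) (s : Set Ω) :
    ∫ ω in s, Φ (L ω) ω ∂μ = ∑ t ∈ Finset.range (k + 1), ∫ ω in s ∩ L ⁻¹' {t}, Φ t ω ∂μ := by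
  simp_rw [eq_sum_indicator_fiber hL Φ]
  rw [integral_finsetSum _ fun t ht =>
    ((hΦ t (Nat.lt_succ_iff.1 (Finset.mem_range.1 ht))).indicator (hLm t)).integrableOn]
  exact Finset.sum_congr rfl fun t _ => setIntegral_indicator (hLm t)

variable [CompleteSpace E]

/-- Conditional expectation of a quantity defined piecewise on the level sets of an observable
variable `L`, given its averages over each of these level sets. -/
theorem condExp_fiber [IsProbabilityMeasure μ] (hI : mI ≤ m0) {L : Ω → ℕ} {k : ℕ}
    (hL : ∀ ω, L ω ≤ k)
    (hLm : ∀ t, MeasurableSet[mI] (L ⁻¹' {t})) {Φ : ℕ → Ω → E}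
    (hΦ : ∀ t ≤ k, Integrable (Φ t) μ) (c : ℕ → E)
    (h : ∀ t ≤ k, ∀ s, MeasurableSet[mI] s →
      ∫ ω in s ∩ L ⁻¹' {t}, Φ t ω ∂μ = μ.real (s ∩ L ⁻¹' {t}) • c t) :
    μ[fun ω => Φ (L ω) ω | mI] =ᵐ[μ] fun ω => c (L ω) := by
  have hLm0 := fun t => hI _ (hLm t)
  refine (ae_eq_condExp_of_forall_setIntegral_eq hI (integrable_fiber hL hLm0 hΦ) (fun s _ _ => ?_)
    (fun s hs _ => ?_) ?_).symm
  · exact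
    (integrable_fiber (Φ := fun t _ => c t) hL hLm0 fun t _ => integrable_const _).integrableOn
  · rw [setIntegral_fiber hL hLm0 hΦ,
      setIntegral_fiber (Φ := fun t _ => c t) hL hLm0 fun t _ => integrable_const _]
    refine Finset.sum_congr rfl fun t ht => ?_
    rw [h t (Nat.lt_succ_iff.1 (Finset.mem_range.1 ht)) s hs, setIntegral_const]
  · have h1 : (fun ω => c (L ω)) = fun ω => ∑ t ∈ Finset.range (k + 1),
        (L ⁻¹' {t}).indicator (fun _ => c t) ω :=
      funext fun ω => eq_sum_indicator_fiber hL (fun t _ => c t) ω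
    rw [h1]
    exact (Finset.stronglyMeasurable_fun_sum _ fun t _ =>
      stronglyMeasurable_const.indicator (hLm t)).aestronglyMeasurable

/-- The conditional expectation of the integrand cut off to `H`, given the independent σ-algebra, is
constant. -/
theorem setIntegral_inter_of_indep [IsProbabilityMeasure μ] (h₁ : m₁ ≤ m0) (h₂ : m₂ ≤ m0)
    (hi : Indep m₁ m₂ μ) {Φ : Ω → E}
    (hΦm : StronglyMeasurable[m₁] Φ) (hΦ : Integrable Φ μ) {H s : Set Ω}
    (hH : MeasurableSet[m₁] H) (hs : MeasurableSet[m₂] s) :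
    ∫ ω in s ∩ H, Φ ω ∂μ = μ.real s • ∫ ω in H, Φ ω ∂μ := by
  have h3 := condExp_indep_eq h₁ h₂ (hΦm.indicator hH) hi
  rw [← setIntegral_indicator (h₁ _ hH),
    ← setIntegral_condExp h₂ (hΦ.indicator (h₁ _ hH)) hs,
    setIntegral_congr_ae (g := fun _ => ∫ ω, H.indicator Φ ω ∂μ) (h₂ _ hs)
      (h3.mono fun ω hω _ => hω), setIntegral_const, integral_indicator (h₁ _ hH)]

end ConditionalExpectation

theorem sum_Ioc_add_eq_sum_fin {M : Type*} [AddCommMonoid M] (f : ℕ → M) (t r : ℕ) :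
    ∑ i ∈ Finset.Ioc t (t + r), f i = ∑ j : Fin r, f (t + 1 + j) := by
  induction r with
  | zero => simp
  | succ r ih =>
    rw [← add_assoc, Finset.sum_Ioc_succ_top (by omega), ih, Fin.sum_univ_castSucc]
    simp [add_right_comm]

/-! ### Open-loop prediction from the last transmission -/

namespace LinearSystem

variable {Ω : Type*} {n m q : ℕ} (S : LinearSystem n m) (N : Inputs Ω n m)

/-- The error at time `k` of the open-loop prediction started from the local estimate at time
`t`. -/
def predErr (t k : ℕ) (ω : Ω) : EuclideanSpace ℝ (Fin n) :=
  S.postErr N k ω + ∑ i ∈ Finset.Ioc t k, (S.A ^ (k - i)).toEuclideanLin (S.innovation N i ω)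

theorem localEst_eq_add_sum {t k : ℕ} (htk : t ≤ k) (ω : Ω) :
    S.localEst N k ω = (S.A ^ (k - t)).toEuclideanLin (S.localEst N t ω) +
      ∑ i ∈ Finset.Ioc t k, (S.A ^ (k - i)).toEuclideanLin (S.innovation N i ω) := by
  induction k, htk using Nat.le_induction with
  | base => simp [Matrix.toEuclideanLin]
  | succ k htk ih =>
    have h1 : S.localEst N (k + 1) ω =
        S.A.toEuclideanLin (S.localEst N k ω) + S.innovation N (k + 1) ω := rfl
    rw [h1, ih, map_add, map_sum, Finset.sum_Ioc_succ_top (by omega), Nat.succ_sub htk, pow_succ',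
      toEuclideanLin_mul_apply, add_assoc]
    congr 2
    · refine Finset.sum_congr rfl fun i hi => ?_
      rw [Nat.succ_sub (Finset.mem_Ioc.1 hi).2, pow_succ', toEuclideanLin_mul_apply]
    · simp [Matrix.toEuclideanLin]

theorem state_eq_add_predErr {t k : ℕ} (htk : t ≤ k) (ω : Ω) :
    S.state N k ω = (S.A ^ (k - t)).toEuclideanLin (S.localEst N t ω) + S.predErr N t k ω := by
  have h1 : S.state N k ω = S.localEst N k ω + S.postErr N k ω := by simp [postErr]
  rw [h1, S.localEst_eq_add_sum N htk, predErr]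
  abel

/-- The conditional error covariance at time `k` when the last transmission was at time `t`. -/
def predCov (q : ℕ) (δ : ℕ → ℝ) (t k : ℕ) : Matrix (Fin n) (Fin n) ℝ :=
  S.postCov k + ∑ i ∈ Finset.range (k - t), eta q δ t k (k - i) •
    (S.A ^ i * (S.priorCov (k - i) - S.postCov (k - i)) * (S.A ^ i)ᵀ)

end LinearSystem

/-- The event that no transmission is triggered at the times in `(t, k]` if the last one before
took place at time `t`. -/
def silentPath {Ω : Type*} {q : ℕ} (δ : ℕ → ℝ) (ε : ℕ → Ω → EuclideanSpace ℝ (Fin q)) (t k : ℕ) :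
    Set Ω :=
  {ω | ∀ j ∈ Finset.Ioc t k, ∑ i ∈ Finset.Ioc t j, ‖ε i ω‖ ^ 2 ≤ δ j}

theorem measurableSet_silentPath {Ω : Type*} {mΩ : MeasurableSpace Ω} {q : ℕ} {δ : ℕ → ℝ}
    {ε : ℕ → Ω → EuclideanSpace ℝ (Fin q)} {t k : ℕ}
    (h : ∀ i ∈ Finset.Ioc t k, Measurable (ε i)) : MeasurableSet (silentPath δ ε t k) := by
  have : silentPath δ ε t k =
      ⋂ j ∈ Finset.Ioc t k, {ω | ∑ i ∈ Finset.Ioc t j, ‖ε i ω‖ ^ 2 ≤ δ j} := by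
    ext; simp [silentPath]
  rw [this]
  refine MeasurableSet.biInter (Finset.countable_toSet _) fun j hj => ?_
  refine measurableSet_le (Finset.measurable_fun_sum _ fun i hi => ?_) measurable_const
  rw [Finset.mem_coe, Finset.mem_Ioc] at hj
  have := h i (by rw [Finset.mem_Ioc] at hi ⊢; omega)
  fun_prop

/-! ### The information of the remote center -/

section Information

variable {Ω : Type*} {n q : ℕ} {δ : ℕ → ℝ} {ε : ℕ → Ω → EuclideanSpace ℝ (Fin q)}
  {γ : ℕ → Ω → ℝ} {xL : ℕ → Ω → EuclideanSpace ℝ (Fin n)}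

theorem measurable_info (γ : ℕ → Ω → ℝ) (xL : ℕ → Ω → EuclideanSpace ℝ (Fin n)) {j k : ℕ}
    (hj : j ≤ k) : Measurable[infoSigma γ xL k] fun ω => (γ j ω • xL j ω, γ j ω) := by
  have h := comap_measurable (m := MeasurableSpace.pi) fun ω (j : Fin (k + 1)) =>
    (γ j ω • xL j ω, γ j ω)
  exact (measurable_pi_apply (⟨j, Nat.lt_succ_of_le hj⟩ : Fin (k + 1))).comp h

theorem measurableSet_lastTx_infoSigma (hγ : γ = fun k ω => decision δ (fun i => ε i ω) k)
    (k t : ℕ) :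
    MeasurableSet[infoSigma γ xL k] ((fun ω => lastTx δ (fun i => ε i ω) (k + 1)) ⁻¹' {t}) := by
  have hm : ∀ j ≤ k, MeasurableSet[infoSigma γ xL k] {ω | γ j ω = 1} := fun j hj =>
    (measurable_snd.comp (measurable_info γ xL hj)) (measurableSet_singleton (1 : ℝ))
  by_cases htk : t ≤ k
  · have h1 : (fun ω => lastTx δ (fun i => ε i ω) (k + 1)) ⁻¹' {t} =
        {ω | γ t ω = 1} ∩ ⋂ j ∈ Finset.Ioc t k, {ω | γ j ω = 1}ᶜ := by
      ext ω
      simp [lastTx_succ_eq_iff_decision, htk, hγ]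
    rw [h1]
    exact (hm t htk).inter (MeasurableSet.biInter (Finset.countable_toSet _) fun j hj =>
      (hm j (Finset.mem_Ioc.1 hj).2).compl)
  · convert! MeasurableSet.empty (α := Ω) using 1
    ext ω
    simp [lastTx_succ_eq_iff_decision, htk]

/-- On the event that the last transmission took place at time `t`, the information at time `k` is
generated by the past up to time `t` and the silence since. -/
theorem exists_past_inter_silentPath {mP : MeasurableSpace Ω}
    (hγ : γ = fun k ω => decision δ (fun i => ε i ω) k) {t k : ℕ} (htk : t ≤ k)
    (hε : ∀ i ≤ t, Measurable[mP] (ε i)) (hx : ∀ i ≤ t, Measurable[mP] (xL i)) {s : Set Ω}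
    (hs : MeasurableSet[infoSigma γ xL k] s) :
    ∃ s', MeasurableSet[mP] s' ∧
      s ∩ (fun ω => lastTx δ (fun i => ε i ω) (k + 1)) ⁻¹' {t} = s' ∩ silentPath δ ε t k := by
  obtain ⟨B, hB, rfl⟩ := hs
  have hγm : ∀ j ≤ t, Measurable[mP] (γ j) := fun j hj => by
    rw [hγ]
    exact (measurable_lastTx_decision fun i hi => hε i (hi.trans hj)).2
  -- During silence the center receives only zeros, so on the event in question the message record
  -- may be replaced by this truncated one, which depends on the past alone.
  let g : Ω → Fin (k + 1) → EuclideanSpace ℝ (Fin n) × ℝ := fun ω j =>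
    if (j : ℕ) ≤ t then (γ j ω • xL j ω, γ j ω) else (0, 0)
  have hg : Measurable[mP] g := by
    refine LinearSystem.measurable_pi_of_forall fun j => ?_
    by_cases hj : (j : ℕ) ≤ t
    · simp only [g, hj, if_true]
      exact ((hγm j hj).smul (hx j hj)).prodMk (hγm j hj)
    · simp only [g, hj, if_false]
      exact measurable_const
  refine ⟨g ⁻¹' B ∩ {ω | γ t ω = 1}, (hg hB).inter (hγm t le_rfl (measurableSet_singleton 1)), ?_⟩
  ext ω
  have h1 := lastTx_succ_eq_iff (δ := δ) (fun i => ε i ω) htk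
  have h2 : lastTx δ (fun i => ε i ω) (k + 1) = t →
      g ω = fun j : Fin (k + 1) => (γ j ω • xL j ω, γ j ω) := by
    intro h
    ext1 j
    simp only [g]
    split_ifs with hj
    · rfl
    · have := ((lastTx_succ_eq_iff_decision _ k t).1 h).2.2 j
        (Finset.mem_Ioc.2 ⟨by omega, by omega⟩)
      have h0 : γ j ω = 0 := by rw [hγ]; exact decision_eq_zero_of_ne_one this
      simp [h0]
  simp only [Set.mem_inter_iff, Set.mem_preimage, Set.mem_singleton_iff, Set.mem_ofPred_eq]
  constructor
  · rintro ⟨ha, hb⟩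
    have h3 := h1.1 hb
    refine ⟨⟨by rwa [h2 hb], ?_⟩, h3.2⟩
    rw [hγ]
    exact h3.1
  · rintro ⟨⟨ha, hb⟩, hc⟩
    rw [hγ] at hb
    have h3 := h1.2 ⟨hb, hc⟩
    exact ⟨by rwa [← h2 h3], h3⟩

end Information

/-! ### Conditional moments of the prediction error -/

section Filter

variable {Ω : Type*} {n m q : ℕ} {S : LinearSystem n m} {N : Inputs Ω n m}
  {U : ℕ → Matrix (Fin n) (Fin n) ℝ} {Λ : ℕ → Fin q → ℝ} {δ : ℕ → ℝ}

theorem measurable_normInnovation {mΩ : MeasurableSpace Ω} {i : ℕ}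
    (h : Measurable (S.innovation N i)) : Measurable (normInnovation S N U Λ i) :=
  (LinearSystem.measurable_toEuclideanLin _).comp h

theorem measurable_predErr {mΩ : MeasurableSpace Ω} {t k : ℕ} (he : Measurable (S.postErr N k))
    (h : ∀ i ∈ Finset.Ioc t k, Measurable (S.innovation N i)) : Measurable (S.predErr N t k) :=
  he.add (Finset.measurable_fun_sum _ fun i hi =>
    (LinearSystem.measurable_toEuclideanLin _).comp (h i hi))

variable [MeasurableSpace Ω] {μ : Measure Ω} [IsProbabilityMeasure μ]

theorem memLp_predErr (hN : N.IsGaussianWhite μ S) (hP0 : S.initCov.PosDef) (hR : S.R.PosDef)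
    (hQ : S.Q.PosSemidef) (t k : ℕ) : MemLp (S.predErr N t k) 2 μ :=
  (hN.isCenteredGaussian_postErr hP0 hR hQ k).memLp.add (memLp_finsetSum _ fun i _ =>
    memLp_toEuclideanLin (hN.isCenteredGaussian_innovation hP0 hR hQ i).memLp _)

theorem memLp_localEst (hN : N.IsGaussianWhite μ S) (hP0 : S.initCov.PosDef) (hR : S.R.PosDef)
    (hQ : S.Q.PosSemidef) (k : ℕ) : MemLp (S.localEst N k) 2 μ := by
  have h1 : S.localEst N k = fun ω => S.state N k ω - S.postErr N k ω := by
    ext1 ω; simp [LinearSystem.postErr]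
  rw [h1]
  exact (hN.memLp_state k).sub (hN.isCenteredGaussian_postErr hP0 hR hQ k).memLp

/-- The prediction error and the silence event are both functions of the first variable, so neither
is affected by what was known at time `t`. -/
theorem indepFun_future_past (hN : N.IsGaussianWhite μ S) (hP0 : S.initCov.PosDef)
    (hR : S.R.PosDef) (hQ : S.Q.PosSemidef) {t k : ℕ} (htk : t ≤ k) :
    IndepFun (fun ω => (S.postErr N k ω, fun i : Finset.Ioc t k => S.innovation N i ω))
      (fun ω (i : Finset.range (t + 1)) => S.innovation N i ω) μ := by
  have hz := hN.measurable_innovation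
  have h1 : IndepFun (fun ω (i : Finset.Ioc t k) => S.innovation N i ω)
      (fun ω (i : Finset.range (t + 1)) => S.innovation N i ω) μ := by
    refine (hN.iIndepFun_innovation hP0 hR hQ).indepFun_finset _ _ ?_ hz
    rw [Finset.disjoint_left]
    intro i hi hi'
    rw [Finset.mem_Ioc] at hi
    rw [Finset.mem_range] at hi'
    omega
  have h2 := hN.indepFun_postErr hP0 hR hQ k
  refine indepFun_prodMk_left_of_right (hN.measurable_postErr k) (by fun_prop) (by fun_prop) ?_ h1
  refine IndepFun.of_measurable_comap_right h2 ?_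
  have hf := comap_measurable (m := MeasurableSpace.pi)
    (fun ω (j : Finset.range (k + 1)) => S.innovation N j ω)
  have hj : ∀ j ≤ k, Measurable[MeasurableSpace.comap
      (fun ω (j : Finset.range (k + 1)) => S.innovation N j ω) inferInstance] (S.innovation N j) :=
    fun j hj =>
      (measurable_pi_apply (⟨j, Finset.mem_range.2 (by omega)⟩ : Finset.range (k + 1))).comp hf
  refine Measurable.prodMk (LinearSystem.measurable_pi_of_forall fun i => hj i ?_)
    (LinearSystem.measurable_pi_of_forall fun i => hj i ?_)
  · exact (Finset.mem_Ioc.1 i.2).2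
  · have := Finset.mem_range.1 i.2
    omega

/-- First and second moments of the prediction error on the event of silence. -/
theorem setIntegral_predErr (hN : N.IsGaussianWhite μ S) (hP0 : S.initCov.PosDef)
    (hR : S.R.PosDef) (hQ : S.Q.PosSemidef) (hqn : q ≤ n)
    (hU : ∀ k, IsSpectralDecomposition (S.innovCov k) (U k) (Λ k)) {t k : ℕ} (htk : t ≤ k) :
    (∀ a, ∫ ω in silentPath δ (normInnovation S N U Λ) t k, S.predErr N t k ω a ∂μ = 0) ∧
      ∀ a b, ∫ ω in silentPath δ (normInnovation S N U Λ) t k,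
          S.predErr N t k ω a * S.predErr N t k ω b ∂μ =
        S.predCov q δ t k a b * μ.real (silentPath δ (normInnovation S N U Λ) t k) := by
  obtain ⟨r, rfl⟩ := Nat.exists_eq_add_of_le htk
  set k := t + r with hk
  set ε := normInnovation S N U Λ with hε
  set H := silentPath δ ε t k with hH
  have hzm := hN.measurable_innovation
  have hεm : ∀ i, Measurable (ε i) := fun i => measurable_normInnovation (hzm i)
  have hZ := hN.isCenteredGaussian_innovation hP0 hR hQ
  have hE := hN.isCenteredGaussian_postErr hP0 hR hQ k
  have hHm : MeasurableSet H := measurableSet_silentPath fun i _ => hεm i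
  choose B hB hFB using fun i => (hU i).exists_factor hqn
  have hw := fun i => (hZ i).whiten (hB i) (hFB i)
  let Y : ℕ → Ω → EuclideanSpace ℝ (Fin n) :=
    fun i ω => (S.A ^ (k - i)).toEuclideanLin (S.innovation N i ω)
  have hY2 : ∀ i, MemLp (Y i) 2 μ := fun i => memLp_toEuclideanLin (hZ i).memLp _
  have hi : iIndepFun ε μ := (hN.iIndepFun_innovation hP0 hR hQ).comp
    (fun i => (normalizer (U i) (Λ i)).toEuclideanLin)
    fun i => LinearSystem.measurable_toEuclideanLin _
  obtain ⟨hY, hYY⟩ := setIntegral_silent_linear_image (Z := Y) (B := fun i => S.A ^ (k - i) * B i)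
    hεm hi (fun i => (hw i).1) (fun i => by
      filter_upwards [(hw i).2] with ω hω
      simp only [Y]
      rw [toEuclideanLin_mul_apply]
      congr 1) δ t r (H := H) (by
      ext ω
      exact forall_Ioc_iff_mem_silentEvent (δ := δ) (fun i => ε i ω) t r)
  have hBB : ∀ i, S.A ^ (k - i) * B i * (S.A ^ (k - i) * B i)ᵀ =
      S.A ^ (k - i) * S.innovCov i * (S.A ^ (k - i))ᵀ := by
    intro i
    rw [← hB i, Matrix.transpose_mul]
    simp only [Matrix.mul_assoc]
  have hD : ∀ ω, S.predErr N t k ω = S.postErr N k ω + ∑ j : Fin r, Y (t + 1 + j) ω :=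
    fun ω => by rw [LinearSystem.predErr, hk, sum_Ioc_add_eq_sum_fin]
  -- The filtering error is independent of `z_0, …, z_k`, which determine both `H` and `G`; its
  -- moments on `H` are therefore unconditional, and its cross terms with the innovations vanish.
  have hfac : ∀ (f : EuclideanSpace ℝ (Fin n) → ℝ), Measurable f → ∀ G : Ω → ℝ,
      Measurable[MeasurableSpace.comap
        (fun ω (j : Finset.range (k + 1)) => S.innovation N j ω) inferInstance] G →
      ∫ ω in H, f (S.postErr N k ω) * G ω ∂μ =
        (∫ ω, f (S.postErr N k ω) ∂μ) * ∫ ω in H, G ω ∂μ := by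
    intro f hf G hG
    have hzj : ∀ j ≤ k, Measurable[MeasurableSpace.comap
        (fun ω (j : Finset.range (k + 1)) => S.innovation N j ω) inferInstance]
        (S.innovation N j) := fun j hj =>
      (measurable_pi_apply (⟨j, Finset.mem_range.2 (by omega)⟩ : Finset.range (k + 1))).comp
        (comap_measurable (fun ω (j : Finset.range (k + 1)) => S.innovation N j ω))
    have hle : MeasurableSpace.comap
        (fun ω (j : Finset.range (k + 1)) => S.innovation N j ω) inferInstance ≤
        (inferInstance : MeasurableSpace Ω) := by
      have : Measurable fun ω (j : Finset.range (k + 1)) => S.innovation N j ω := by fun_prop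
      exact this.comap_le
    have hHm' : MeasurableSet[MeasurableSpace.comap
        (fun ω (j : Finset.range (k + 1)) => S.innovation N j ω) inferInstance] H :=
      measurableSet_silentPath fun i hi =>
        measurable_normInnovation (hzj i (Finset.mem_Ioc.1 hi).2)
    have h1 : IndepFun (fun ω => f (S.postErr N k ω)) (H.indicator G) μ :=
      IndepFun.of_measurable_comap_right (IndepFun.of_eq_comp_left
        (hN.indepFun_postErr hP0 hR hQ k) f hf fun _ => rfl) (hG.indicator hHm')
    have h2 := h1.integral_fun_mul_eq_mul_integral
      (hf.comp (hN.measurable_postErr k)).aestronglyMeasurable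
      ((hG.indicator hHm').mono hle le_rfl).aestronglyMeasurable
    rw [integral_indicator hHm] at h2
    rw [← h2, ← integral_indicator hHm]
    congr 1 with ω
    by_cases hω : ω ∈ H <;> simp [hω]
  have hYm : ∀ (j : Fin r) a, Measurable[MeasurableSpace.comap
        (fun ω (j : Finset.range (k + 1)) => S.innovation N j ω) inferInstance]
        fun ω => Y (t + 1 + j) ω a := by
    intro j a
    have h1 : Measurable[MeasurableSpace.comap
        (fun ω (j : Finset.range (k + 1)) => S.innovation N j ω) inferInstance]
        (S.innovation N (t + 1 + j)) :=
      (measurable_pi_apply (⟨t + 1 + j, Finset.mem_range.2 (by omega)⟩ :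
        Finset.range (k + 1))).comp
        (comap_measurable (fun ω (j : Finset.range (k + 1)) => S.innovation N j ω))
    exact (show Measurable fun x : EuclideanSpace ℝ (Fin n) => x a by fun_prop).comp
      ((LinearSystem.measurable_toEuclideanLin _).comp h1)
  have hEa : ∀ a, ∫ ω in H, S.postErr N k ω a ∂μ = 0 := by
    intro a
    have := hfac (fun x => x a) (by fun_prop) (fun _ => 1) measurable_const
    simpa [hE.mean a] using this
  have hEE : ∀ a b, ∫ ω in H, S.postErr N k ω a * S.postErr N k ω b ∂μ =
      S.postCov k a b * μ.real H := by
    intro a b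
    have := hfac (fun x => x a * x b) (by fun_prop) (fun _ => 1) measurable_const
    simpa [← hE.cov, crossMoment] using this
  have hEY : ∀ a b (j : Fin r), ∫ ω in H, S.postErr N k ω a * Y (t + 1 + j) ω b ∂μ = 0 := by
    intro a b j
    rw [hfac (fun x => x a) (by fun_prop) _ (hYm j b), hE.mean, zero_mul]
  have hsum : ∀ (x : Fin r → EuclideanSpace ℝ (Fin n)) a, (∑ j, x j) a = ∑ j, x j a := by
    intro x a
    simp
  refine ⟨fun a => ?_, fun a b => ?_⟩
  · simp only [hD, PiLp.add_apply, hsum]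
    rw [integral_add ((memLp_coord hE.memLp a).integrable (by norm_num)).integrableOn
      (integrable_finsetSum _ fun j _ =>
        ((memLp_coord (hY2 _) a).integrable (by norm_num)).integrableOn), hEa,
      integral_finsetSum _ fun j _ =>
        ((memLp_coord (hY2 _) a).integrable (by norm_num)).integrableOn]
    simp [hY]
  · have hexp : ∀ ω, S.predErr N t k ω a * S.predErr N t k ω b =
        S.postErr N k ω a * S.postErr N k ω b +
        ((∑ j : Fin r, S.postErr N k ω a * Y (t + 1 + j) ω b) +
        ((∑ j : Fin r, S.postErr N k ω b * Y (t + 1 + j) ω a) +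
          ∑ i : Fin r, ∑ j : Fin r, Y (t + 1 + i) ω a * Y (t + 1 + j) ω b)) := by
      intro ω
      simp only [hD, PiLp.add_apply, hsum]
      rw [← Finset.mul_sum, ← Finset.mul_sum, ← Finset.sum_mul_sum]
      ring
    have i1 : Integrable (fun ω => S.postErr N k ω a * S.postErr N k ω b) (μ.restrict H) :=
      (integrable_coord_mul_coord hE.memLp hE.memLp a b).integrableOn
    have i2 : ∀ a b (j : Fin r), Integrable
        (fun ω => S.postErr N k ω a * Y (t + 1 + j) ω b) (μ.restrict H) := fun a b j =>
      (integrable_coord_mul_coord hE.memLp (hY2 _) a b).integrableOn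
    have i3 : ∀ i j : Fin r, Integrable
        (fun ω => Y (t + 1 + i) ω a * Y (t + 1 + j) ω b) (μ.restrict H) := fun i j =>
      (integrable_coord_mul_coord (hY2 _) (hY2 _) a b).integrableOn
    have j2 := fun a b => integrable_finsetSum Finset.univ fun j _ => i2 a b j
    have j3 := integrable_finsetSum Finset.univ fun i _ =>
      integrable_finsetSum Finset.univ fun j _ => i3 i j
    have j4 : Integrable (fun ω => (∑ j : Fin r, S.postErr N k ω b * Y (t + 1 + j) ω a) +
        ∑ i : Fin r, ∑ j : Fin r, Y (t + 1 + i) ω a * Y (t + 1 + j) ω b) (μ.restrict H) :=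
      (j2 b a).add j3
    have j5 : Integrable (fun ω => (∑ j : Fin r, S.postErr N k ω a * Y (t + 1 + j) ω b) +
        ((∑ j : Fin r, S.postErr N k ω b * Y (t + 1 + j) ω a) +
        ∑ i : Fin r, ∑ j : Fin r, Y (t + 1 + i) ω a * Y (t + 1 + j) ω b)) (μ.restrict H) :=
      (j2 a b).add j4
    simp_rw [hexp]
    rw [integral_add i1 j5, integral_add (j2 a b) j4, integral_add (j2 b a) j3, hEE,
      integral_finsetSum _ fun j _ => i2 a b j,
      integral_finsetSum _ fun j _ => i2 b a j, integral_finsetSum _ fun i _ =>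
      integrable_finsetSum Finset.univ fun j _ => i3 i j]
    simp_rw [integral_finsetSum _ fun j _ => i3 _ j, hEY, hYY, hBB]
    simp only [Finset.sum_const_zero, zero_add, ite_mul, zero_mul, Finset.sum_ite_eq,
      Finset.mem_univ, if_true, LinearSystem.predCov, Matrix.add_apply, add_mul]
    congr 1
    -- `predCov` sums over the lag `k - i` and the moment computation over the position after `t`;
    -- reversing the range matches the two.
    rw [show k - t = r by omega, ← Finset.sum_range_reflect, Finset.sum_range, Matrix.sum_apply,
      Finset.sum_mul]
    refine Finset.sum_congr rfl fun j _ => ?_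
    rw [show k - (r - 1 - (j : ℕ)) = t + 1 + j by omega,
      show k - (t + 1 + (j : ℕ)) = r - 1 - j by omega, Matrix.smul_apply, smul_eq_mul,
      LinearSystem.innovCov]

/-- Conditional expectation, given the information at the remote center, of a function of the
prediction error since the last transmission. -/
theorem condExp_predErr (hN : N.IsGaussianWhite μ S) (hP0 : S.initCov.PosDef) (hR : S.R.PosDef)
    (hQ : S.Q.PosSemidef) {γ : ℕ → Ω → ℝ}
    (hγ : γ = fun k ω => decision δ (fun i => normInnovation S N U Λ i ω) k) (k : ℕ)
    {L : Ω → ℕ} (hL : L = fun ω => lastTx δ (fun i => normInnovation S N U Λ i ω) (k + 1))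
    {g : EuclideanSpace ℝ (Fin n) → ℝ} (hg : Measurable g)
    (hgi : ∀ t, Integrable (fun ω => g (S.predErr N t k ω)) μ) (c : ℕ → ℝ)
    (hc : ∀ t ≤ k, ∫ ω in silentPath δ (normInnovation S N U Λ) t k, g (S.predErr N t k ω) ∂μ =
      c t * μ.real (silentPath δ (normInnovation S N U Λ) t k)) :
    μ[fun ω => g (S.predErr N (L ω) k ω) | infoSigma γ (S.localEst N) k] =ᵐ[μ]
      fun ω => c (L ω) := by
  have hz := hN.measurable_innovation
  have hI : infoSigma γ (S.localEst N) k ≤ (inferInstance : MeasurableSpace Ω) := by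
    refine Measurable.comap_le (measurable_pi_lambda _ fun j => ?_)
    have h1 : Measurable (γ j) := by
      rw [hγ]
      exact (measurable_lastTx_decision fun i _ => measurable_normInnovation (hz i)).2
    exact (h1.smul (LinearSystem.measurable_localEst_of_innovation fun i _ => hz i)).prodMk h1
  have hLk : ∀ ω, L ω ≤ k := fun ω => by
    rw [hL]
    exact Nat.lt_succ_iff.1 (lastTx_lt _ _ (by omega))
  refine condExp_fiber (Φ := fun t ω => g (S.predErr N t k ω)) hI hLk (fun t => ?_)
    (fun t _ => hgi t) c fun t htk s hs => ?_
  · rw [hL]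
    exact measurableSet_lastTx_infoSigma hγ k t
  · set past : Ω → Finset.range (t + 1) → EuclideanSpace ℝ (Fin n) :=
      fun ω i => S.innovation N i ω with hpast
    set future : Ω → EuclideanSpace ℝ (Fin n) × (Finset.Ioc t k → EuclideanSpace ℝ (Fin n)) :=
      fun ω => (S.postErr N k ω, fun i => S.innovation N i ω) with hfuture
    have hpm : Measurable past := by fun_prop
    have hfm : Measurable future := (hN.measurable_postErr k).prodMk (by fun_prop)
    have hzp : ∀ i ≤ t, Measurable[MeasurableSpace.comap past inferInstance]
        (S.innovation N i) := fun i hi =>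
      (measurable_pi_apply (⟨i, Finset.mem_range.2 (by omega)⟩ : Finset.range (t + 1))).comp
        (comap_measurable past)
    have hzf : ∀ i ∈ Finset.Ioc t k, Measurable[MeasurableSpace.comap future inferInstance]
        (S.innovation N i) := fun i hi =>
      (measurable_pi_apply (⟨i, hi⟩ : Finset.Ioc t k)).comp
        (measurable_snd.comp (comap_measurable future))
    have hef : Measurable[MeasurableSpace.comap future inferInstance] (S.postErr N k) :=
      measurable_fst.comp (comap_measurable future)
    have hind := (IndepFun_iff_Indep _ _ _).1 (indepFun_future_past hN hP0 hR hQ htk)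
    obtain ⟨s', hs', hss'⟩ := exists_past_inter_silentPath
      (mP := MeasurableSpace.comap past inferInstance) hγ htk
        (fun i hi => measurable_normInnovation (hzp i hi))
      (fun i hi => LinearSystem.measurable_localEst_of_innovation fun j hj => hzp j (hj.trans hi))
      hs
    have hH : MeasurableSet[MeasurableSpace.comap future inferInstance]
        (silentPath δ (normInnovation S N U Λ) t k) :=
      measurableSet_silentPath fun i hi => measurable_normInnovation (hzf i hi)
    have h1 := setIntegral_inter_of_indep hfm.comap_le hpm.comap_le hind
      (hg.comp (measurable_predErr hef hzf)).stronglyMeasurable (hgi t) hH hs'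
    -- The constant integrand shows that the probability factors in the same way as the integral, so
    -- the contribution of the past cancels.
    have h2 := setIntegral_inter_of_indep (Φ := fun _ => (1 : ℝ)) hfm.comap_le hpm.comap_le hind
      stronglyMeasurable_const (integrable_const _) hH hs'
    simp only [setIntegral_const, smul_eq_mul, mul_one] at h2
    rw [hL, hss', h2, smul_eq_mul]
    refine h1.trans ?_
    simp only [Function.comp_apply]
    rw [hc t htk, smul_eq_mul]
    ring

/-- The MMSE estimate is the open-loop prediction from the last received local estimate. -/
theorem mmseEst_state (hN : N.IsGaussianWhite μ S) (hP0 : S.initCov.PosDef) (hR : S.R.PosDef)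
    (hQ : S.Q.PosSemidef) (hqn : q ≤ n)
    (hU : ∀ k, IsSpectralDecomposition (S.innovCov k) (U k) (Λ k)) {γ : ℕ → Ω → ℝ}
    (hγ : γ = fun k ω => decision δ (fun i => normInnovation S N U Λ i ω) k) (k : ℕ)
    {L : Ω → ℕ} (hL : L = fun ω => lastTx δ (fun i => normInnovation S N U Λ i ω) (k + 1)) :
    mmseEst (infoSigma γ (S.localEst N) k) μ (S.state N k) =ᵐ[μ]
      fun ω => (S.A ^ (k - L ω)).toEuclideanLin (S.localEst N (L ω) ω) := by
  have hLk : ∀ ω, L ω ≤ k := fun ω => by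
    rw [hL]
    exact Nat.lt_succ_iff.1 (lastTx_lt _ _ (by omega))
  have hz := hN.measurable_innovation
  have hγm : ∀ j, Measurable (γ j) := fun j => by
    rw [hγ]
    exact (measurable_lastTx_decision fun i _ => measurable_normInnovation (hz i)).2
  have hI : infoSigma γ (S.localEst N) k ≤ (inferInstance : MeasurableSpace Ω) :=
    Measurable.comap_le (measurable_pi_lambda _ fun j => ((hγm j).smul
      (LinearSystem.measurable_localEst_of_innovation fun i _ => hz i)).prodMk (hγm j))
  have hLI : ∀ t, MeasurableSet[infoSigma γ (S.localEst N) k] (L ⁻¹' {t}) := fun t => by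
    rw [hL]
    exact measurableSet_lastTx_infoSigma hγ k t
  have hLm := fun t => hI _ (hLI t)
  have hDi : Integrable (fun ω => S.predErr N (L ω) k ω) μ :=
    integrable_fiber (Φ := fun t ω => S.predErr N t k ω) hLk hLm fun t _ =>
      (memLp_predErr hN hP0 hR hQ t k).integrable (by norm_num)
  have hBi : Integrable (fun ω => (S.A ^ (k - L ω)).toEuclideanLin (S.localEst N (L ω) ω)) μ :=
    integrable_fiber (Φ := fun t ω => (S.A ^ (k - t)).toEuclideanLin (S.localEst N t ω)) hLk hLm
      fun t _ => (memLp_toEuclideanLin (memLp_localEst hN hP0 hR hQ t) _).integrable (by norm_num)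
  -- The local estimate itself is not observable at every time. At the latest transmission time `γ =
  -- 1`, so it coincides there with the received product.
  have hBm : StronglyMeasurable[infoSigma γ (S.localEst N) k]
      fun ω => (S.A ^ (k - L ω)).toEuclideanLin (S.localEst N (L ω) ω) := by
    have h1 : (fun ω => (S.A ^ (k - L ω)).toEuclideanLin (S.localEst N (L ω) ω)) =
        fun ω => ∑ t ∈ Finset.range (k + 1), (L ⁻¹' {t}).indicator
          (fun ω => (S.A ^ (k - t)).toEuclideanLin (γ t ω • S.localEst N t ω)) ω := by
      ext1 ω
      rw [← eq_sum_indicator_fiber hLk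
        (fun t ω => (S.A ^ (k - t)).toEuclideanLin (γ t ω • S.localEst N t ω)) ω]
      have h2 : γ (L ω) ω = 1 := by
        rw [hγ]
        exact ((lastTx_succ_eq_iff_decision _ k (L ω)).1 (by rw [hL])).2.1
      rw [h2, one_smul]
    rw [h1]
    refine Finset.stronglyMeasurable_fun_sum _ fun t ht => ?_
    have h2 := (LinearSystem.measurable_toEuclideanLin (S.A ^ (k - t))).comp (measurable_fst.comp
      (measurable_info γ (S.localEst N) (Nat.lt_succ_iff.1 (Finset.mem_range.1 ht))))
    exact h2.stronglyMeasurable.indicator (hLI t)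
  have hD0 : μ[fun ω => S.predErr N (L ω) k ω | infoSigma γ (S.localEst N) k] =ᵐ[μ] 0 := by
    have h1 : ∀ a : Fin n, ∀ᵐ ω ∂μ,
        (μ[fun ω => S.predErr N (L ω) k ω | infoSigma γ (S.localEst N) k]) ω a = 0 := by
      intro a
      have h2 := condExp_predErr hN hP0 hR hQ hγ k hL (g := fun x => x a) (by fun_prop)
        (fun t => (memLp_coord (memLp_predErr hN hP0 hR hQ t k) a).integrable (by norm_num))
        (fun _ => 0) fun t htk => by
          rw [(setIntegral_predErr hN hP0 hR hQ hqn hU htk).1 a, zero_mul]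
      have h3 := (EuclideanSpace.proj (𝕜 := ℝ) a).comp_condExp_comm
        (m := infoSigma γ (S.localEst N) k) hDi
      filter_upwards [h2, h3] with ω hω hω'
      exact hω'.trans hω
    filter_upwards [ae_all_iff.2 h1] with ω hω
    ext a
    exact hω a
  have hsum : S.state N k = (fun ω => (S.A ^ (k - L ω)).toEuclideanLin (S.localEst N (L ω) ω)) +
      fun ω => S.predErr N (L ω) k ω :=
    funext fun ω => S.state_eq_add_predErr N (hLk ω) ω
  rw [mmseEst, hsum]
  refine (condExp_add hBi hDi _).trans ?_
  rw [condExp_of_stronglyMeasurable hI hBm hBi]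
  filter_upwards [hD0] with ω hω
  rw [Pi.add_apply, hω, Pi.zero_apply, add_zero]

/-- Subtracting the estimate from the state leaves exactly the prediction error since the last
transmission, whose conditional second moments are known. -/
theorem mmseCov_state (hN : N.IsGaussianWhite μ S) (hP0 : S.initCov.PosDef) (hR : S.R.PosDef)
    (hQ : S.Q.PosSemidef) (hqn : q ≤ n)
    (hU : ∀ k, IsSpectralDecomposition (S.innovCov k) (U k) (Λ k)) {γ : ℕ → Ω → ℝ}
    (hγ : γ = fun k ω => decision δ (fun i => normInnovation S N U Λ i ω) k) (k : ℕ)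
    {L : Ω → ℕ} (hL : L = fun ω => lastTx δ (fun i => normInnovation S N U Λ i ω) (k + 1)) :
    ∀ᵐ ω ∂μ, mmseCov (infoSigma γ (S.localEst N) k) μ (S.state N k) ω =
      S.predCov q δ (L ω) k := by
  have hLk : ∀ ω, L ω ≤ k := fun ω => by
    rw [hL]
    exact Nat.lt_succ_iff.1 (lastTx_lt _ _ (by omega))
  have hest := mmseEst_state hN hP0 hR hQ hqn hU hγ k hL
  have h1 : ∀ a b : Fin n, ∀ᵐ ω ∂μ,
      mmseCov (infoSigma γ (S.localEst N) k) μ (S.state N k) ω a b =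
        S.predCov q δ (L ω) k a b := by
    intro a b
    have h2 := condExp_predErr hN hP0 hR hQ hγ k hL (g := fun x => x a * x b) (by fun_prop)
      (fun t => integrable_coord_mul_coord (memLp_predErr hN hP0 hR hQ t k)
        (memLp_predErr hN hP0 hR hQ t k) a b)
      (fun t => S.predCov q δ t k a b) fun t htk =>
        (setIntegral_predErr hN hP0 hR hQ hqn hU htk).2 a b
    have h3 : (fun ω => (S.state N k ω -
          mmseEst (infoSigma γ (S.localEst N) k) μ (S.state N k) ω) a *
        (S.state N k ω - mmseEst (infoSigma γ (S.localEst N) k) μ (S.state N k) ω) b) =ᵐ[μ]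
        fun ω => S.predErr N (L ω) k ω a * S.predErr N (L ω) k ω b := by
      filter_upwards [hest] with ω hω
      rw [hω, S.state_eq_add_predErr N (hLk ω), add_sub_cancel_left]
    filter_upwards [condExp_congr_ae (m := infoSigma γ (S.localEst N) k) h3, h2] with ω hω hω'
    rw [mmseCov, Matrix.of_apply, hω, hω']
  filter_upwards [ae_all_iff.2 fun a => ae_all_iff.2 (h1 a)] with ω hω
  ext a b
  exact hω a b

end Filter

end RemoteEstimation

end

/-! ### From the closed form to the recursion -/

open RemoteEstimation
theorem theorem1 {Ω : Type*} [MeasurableSpace Ω] (μ : Measure Ω) [IsProbabilityMeasure μ]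
    {n m q : ℕ} (S : LinearSystem n m) (hq : S.C.rank = q)
    (hP0 : S.initCov.PosDef) (hR : S.R.PosDef) (hQ : S.Q.PosSemidef)
    (hAQ : (S.A * S.Aᵀ + S.Q).PosDef)
    (N : Inputs Ω n m) (hN : N.IsGaussianWhite μ S)
    (U : ℕ → Matrix (Fin n) (Fin n) ℝ) (Λ : ℕ → Fin q → ℝ)
    (hU : ∀ k, IsSpectralDecomposition (S.innovCov k) (U k) (Λ k))
    (δ : ℕ → ℝ)
    (ε : ℕ → Ω → EuclideanSpace ℝ (Fin q)) (hε : ε = normInnovation S N U Λ)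
    (γ : ℕ → Ω → ℝ) (hγ : γ = fun k ω => decision δ (fun i => ε i ω) k)
    (xhat : ℕ → Ω → EuclideanSpace ℝ (Fin n))
    (hxhat : ∀ k, xhat k = mmseEst (infoSigma γ (S.localEst N) k) μ (S.state N k))
    (P : ℕ → Ω → Matrix (Fin n) (Fin n) ℝ)
    (hP : ∀ k, P k = mmseCov (infoSigma γ (S.localEst N) k) μ (S.state N k)) :
    (∀ k, MemLp (S.state N k) 2 μ) ∧
    xhat 0 =ᵐ[μ] S.localEst N 0 ∧
    (∀ᵐ ω ∂μ, P 0 ω = S.postCov 0) ∧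
    ∀ k, 1 ≤ k →
      (∀ᵐ ω ∂μ, xhat k ω =
        (1 - γ k ω) • S.A.toEuclideanLin (xhat (k - 1) ω) + γ k ω • S.localEst N k ω) ∧
      (∀ᵐ ω ∂μ, P k ω = S.postCov k + (1 - γ k ω) •
        ∑ i ∈ Finset.range (k - lastTx δ (fun j => ε j ω) k),
          eta q δ (lastTx δ (fun j => ε j ω) k) k (k - i) •
            (S.A ^ i * (S.priorCov (k - i) - S.postCov (k - i)) * (S.A ^ i)ᵀ)) := by
  subst hε
  have hqn : q ≤ n := hq ▸ S.C.rank_le_width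
  have hx := fun k => mmseEst_state hN hP0 hR hQ hqn hU hγ k rfl
  have hC := fun k => mmseCov_state hN hP0 hR hQ hqn hU hγ k rfl
  simp only [← hxhat, ← hP] at hx hC
  have h0 : ∀ ω, lastTx δ (fun i => normInnovation S N U Λ i ω) (0 + 1) = 0 := fun ω =>
    Nat.lt_one_iff.1 (lastTx_lt _ _ le_rfl)
  -- The closed forms refer to the latest transmission up to and including `k`, the theorem to the
  -- latest one strictly before `k`. They differ exactly when `k` transmits, and then the sum in the
  -- closed form is empty.
  have hlast : ∀ k ω, lastTx δ (fun i => normInnovation S N U Λ i ω) (k + 1) =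
      if γ k ω = 1 then k else lastTx δ (fun i => normInnovation S N U Λ i ω) k := fun k ω => by
    rw [lastTx_succ, hγ]
  have hγ0 : ∀ k ω, γ k ω ≠ 1 → γ k ω = 0 := fun k ω h => by
    rw [hγ] at h ⊢
    exact decision_eq_zero_of_ne_one h
  refine ⟨hN.memLp_state, ?_, ?_, fun k hk => ⟨?_, ?_⟩⟩
  · filter_upwards [hx 0] with ω hω
    rw [hω, h0]
    simp [Matrix.toEuclideanLin]
  · filter_upwards [hC 0] with ω hω
    rw [hω, h0]
    simp [LinearSystem.predCov]
  · filter_upwards [hx k, hx (k - 1)] with ω hω hω'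
    rw [hω, hω', hlast, Nat.sub_add_cancel hk]
    by_cases h : γ k ω = 1
    · simp [h, Matrix.toEuclideanLin]
    · have hlt := lastTx_lt δ (fun i => normInnovation S N U Λ i ω) hk
      -- In silence the estimates at `k - 1` and `k` start from the same transmission, so they
      -- differ by one factor of `A`.
      rw [if_neg h, hγ0 k ω h, sub_zero, one_smul, zero_smul, add_zero, ← toEuclideanLin_mul_apply,
        ← pow_succ']
      congr 3
      omega
  · filter_upwards [hC k] with ω hω
    rw [hω, hlast]
    by_cases h : γ k ω = 1
    · simp [h, LinearSystem.predCov]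
    · rw [if_neg h, hγ0 k ω h, sub_zero, one_smul, LinearSystem.predCov]
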